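/- Let $\mathscr{C}$ be the monoidal category of finite dimensional modules over the complex Lie algebra $\mathfrak{sl}_3=\mathfrak{sl}_3(\mathbb{C})$, with tensor product over $\mathbb{C}$. Let $\mathrm{F}=\mathbb{C}^3$ be the natural module and $\mathrm{F}^*$ its dual. A $\mathscr{C}$-module category is a $\mathbb{C}$-linear additive category $\mathcal{M}$ with a left action of $\mathscr{C}$ (with coherent associativity and unit isomorphisms) whose action bifunctor $\mathscr{C}\times\mathcal{M}\to\mathcal{M}$ is $\mathbb{C}$-bilinear on morphisms. It is *locally finitary* if $\mathcal{M}$ is idempotent split and Krull--Schmidt, has at most countably many indecomposable objects up to isomorphism, and all its morphism spaces are finite dimensional. It is *admissible* if, in addition, $\mathcal{M}$ has weak kernels. It is *simple* if $\mathcal{M}$ is non-zero and its only two-sided ideals stable under the action of $\mathscr{C}$ are the zero ideal and $\mathcal{M}$ itself. For a locally finitary $\mathcal{M}$ with representatives $\{X_i\}_{i\in I}$ of the isomorphism classes of indecomposable objects, and for $\theta\in\mathscr{C}$, let $\Gamma_\theta$ be the oriented graph with vertex set $I$ in which the number of edges from $j$ to $i$ is the multiplicity of $X_i$ as a direct summand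 of $\theta(X_j)$. The *graph* of $\mathcal{M}$ is $\Gamma_{\mathrm{F}}$ and the *dual graph* of $\mathcal{M}$ is $\Gamma_{\mathrm{F}^*}$. **Theorem.** Let $\mathcal{M}$ be an admissible simple $\mathscr{C}$-module category whose graph is isomorphic to the graph, and whose dual graph is isomorphic to the dual graph, of the left regular $\mathscr{C}$-module category ${}_{\mathscr{C}}\mathscr{C}$ (that is, $\mathscr{C}$ acting on itself by tensoring from the left). Then $\mathcal{M}$ is equivalent to ${}_{\mathscr{C}}\mathscr{C}$ as a $\mathscr{C}$-module category: there is a $\mathbb{C}$-linear functor between them that is an equivalence of categories and a (strong) $\mathscr{C}$-module functor. -/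

import Mathlib

open CategoryTheory CategoryTheory.Limits CategoryTheory.MonoidalCategory
open scoped CategoryTheory.MonoidalCategory.MonoidalLeftAction TensorProduct

noncomputable section

/-! ### Finite dimensional modules over a complex Lie algebra -/

/-- A finite dimensional module over the complex Lie algebra `L`. -/
structure FDLieMod (L : Type) [LieRing L] [LieAlgebra ℂ L] : Type 1 where
  carrier : Type
  [addCommGroup : AddCommGroup carrier]
  [module : Module ℂ carrier]
  [lieRingModule : LieRingModule L carrier]
  [lieModule : LieModule ℂ L carrier]
  [finiteDimensional : FiniteDimensional ℂ carrier]

namespace FDLieMod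

variable {L : Type} [LieRing L] [LieAlgebra ℂ L]

instance : CoeSort (FDLieMod L) Type := ⟨FDLieMod.carrier⟩

attribute [instance] addCommGroup module lieRingModule lieModule finiteDimensional

/-- Morphisms are the homomorphisms of Lie modules. -/
instance : Category (FDLieMod L) where
  Hom V W := V →ₗ⁅ℂ,L⁆ W
  id V := LieModuleHom.id
  comp f g := LieModuleHom.comp g f

/-- The homomorphism of Lie modules underlying a morphism. -/
def toLie {V W : FDLieMod L} (f : V ⟶ W) : V →ₗ⁅ℂ,L⁆ W := f

/-- The morphism given by a homomorphism of Lie modules. -/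
def ofLie {V W : FDLieMod L} (f : V →ₗ⁅ℂ,L⁆ W) : V ⟶ W := f

theorem hom_ext {V W : FDLieMod L} {f g : V ⟶ W} (h : ∀ v, toLie f v = toLie g v) : f = g :=
  LieModuleHom.ext h

/-- The isomorphism given by an equivalence of Lie modules. -/
def isoOfEquiv {V W : FDLieMod L} (e : V ≃ₗ⁅ℂ,L⁆ W) : V ≅ W where
  hom := ofLie e
  inv := ofLie e.symm
  hom_inv_id := hom_ext fun v => e.symm_apply_apply v
  inv_hom_id := hom_ext fun v => e.apply_symm_apply v

instance : Preadditive (FDLieMod L) where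
  homGroup V W := inferInstanceAs (AddCommGroup (V →ₗ⁅ℂ,L⁆ W))
  add_comp _ _ _ f f' g := hom_ext fun v => map_add (toLie g) (toLie f v) (toLie f' v)
  comp_add _ _ _ _ _ _ := rfl

theorem toLie_sum {V W : FDLieMod L} {ι : Type} (s : Finset ι) (f : ι → (V ⟶ W)) (v : V) :
    toLie (∑ i ∈ s, f i) v = ∑ i ∈ s, toLie (f i) v :=
  map_sum ({ toFun := fun g => toLie g v, map_zero' := rfl, map_add' := fun _ _ => rfl } :
    (V ⟶ W) →+ W) f s

instance : Linear ℂ (FDLieMod L) where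
  homModule V W := inferInstanceAs (Module ℂ (V →ₗ⁅ℂ,L⁆ W))
  smul_comp _ _ _ r f g := hom_ext fun v => map_smul (toLie g) r (toLie f v)
  comp_smul _ _ _ _ _ _ := rfl

/-- The direct sum of finitely many modules. -/
def directSum {n : ℕ} (V : Fin n → FDLieMod L) : FDLieMod L where
  carrier := DirectSum (Fin n) fun i => V i
  finiteDimensional := inferInstance

instance : HasFiniteBiproducts (FDLieMod L) where
  out n :=
    { has_biproduct := fun V => hasBiproduct_of_total
        { pt := directSum V
          π := fun j => ofLie (DirectSum.lieModuleComponent ℂ (Fin n) L (fun i => V i) j)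
          ι := fun j => ofLie (DirectSum.lieModuleOf ℂ (Fin n) L (fun i => V i) j)
          ι_π := by
            intro i j
            split_ifs with h
            · subst h
              exact hom_ext fun v =>
                DirectSum.component.lof_self ℂ (M := fun i => (V i).carrier) i v
            · exact hom_ext fun v =>
                (DirectSum.component.of ℂ (M := fun i => (V i).carrier) j i v).trans (dif_neg h) }
        (by
          refine hom_ext fun v => ?_
          refine (toLie_sum Finset.univ _ v).trans ?_
          exact DirectSum.sum_univ_of (β := fun i => (V i).carrier) v) }

/-- The module `ℂ` with the zero action. -/
def triv : FDLieMod L where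
  carrier := TrivialLieModule ℂ L ℂ
  finiteDimensional := inferInstanceAs (FiniteDimensional ℂ ℂ)

/-- The dual module, `x` acting on functionals by `(x f)(v) = -f (x v)`. -/
def dual (V : FDLieMod L) : FDLieMod L where
  carrier := V →ₗ[ℂ] ℂ

/-- The tensor product over `ℂ`, `x` acting by `x ⊗ 1 + 1 ⊗ x`. -/
def tensor (V W : FDLieMod L) : FDLieMod L where
  carrier := TensorProduct ℂ V W

theorem map_lie_of_tmul {V W X : FDLieMod L} (f : TensorProduct ℂ V W →ₗ[ℂ] X)
    (h : ∀ (x : L) (v : V) (w : W),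
      f (⁅x, v⁆ ⊗ₜ[ℂ] w) + f (v ⊗ₜ[ℂ] ⁅x, w⁆) = ⁅x, f (v ⊗ₜ[ℂ] w)⁆)
    (x : L) (t : TensorProduct ℂ V W) : f ⁅x, t⁆ = ⁅x, f t⁆ := by
  induction t with
  | zero => simp
  | add a b ha hb => rw [lie_add, map_add, ha, hb, map_add, lie_add]
  | tmul v w => rw [TensorProduct.LieModule.lie_tmul_right, map_add, h]

/-- `(U ⊗ V) ⊗ W ≅ U ⊗ (V ⊗ W)`, the usual isomorphism of vector spaces. -/
def assocEquiv (U V W : FDLieMod L) :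
    tensor (tensor U V) W ≃ₗ⁅ℂ,L⁆ tensor U (tensor V W) :=
  { (TensorProduct.assoc ℂ U V W : _ ≃ₗ[ℂ] _) with
    map_lie' := by
      intro x t
      refine map_lie_of_tmul (V := tensor U V) (W := W) (X := tensor U (tensor V W))
        (TensorProduct.assoc ℂ U V W).toLinearMap ?_ x t
      intro x t w
      induction t using TensorProduct.induction_on with
      | zero =>
        change TensorProduct.assoc ℂ U V W (⁅x, (0 : TensorProduct ℂ U V)⁆ ⊗ₜ[ℂ] w) +
          TensorProduct.assoc ℂ U V W ((0 : TensorProduct ℂ U V) ⊗ₜ[ℂ] ⁅x, w⁆) =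
          ⁅x, TensorProduct.assoc ℂ U V W ((0 : TensorProduct ℂ U V) ⊗ₜ[ℂ] w)⁆
        simp
      | add a b ha hb =>
        change TensorProduct.assoc ℂ U V W (⁅x, a⁆ ⊗ₜ[ℂ] w) +
          TensorProduct.assoc ℂ U V W (a ⊗ₜ[ℂ] ⁅x, w⁆) =
          ⁅x, TensorProduct.assoc ℂ U V W (a ⊗ₜ[ℂ] w)⁆ at ha
        change TensorProduct.assoc ℂ U V W (⁅x, b⁆ ⊗ₜ[ℂ] w) +
          TensorProduct.assoc ℂ U V W (b ⊗ₜ[ℂ] ⁅x, w⁆) =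
          ⁅x, TensorProduct.assoc ℂ U V W (b ⊗ₜ[ℂ] w)⁆ at hb
        change TensorProduct.assoc ℂ U V W (⁅x, a + b⁆ ⊗ₜ[ℂ] w) +
          TensorProduct.assoc ℂ U V W ((a + b) ⊗ₜ[ℂ] ⁅x, w⁆) =
          ⁅x, TensorProduct.assoc ℂ U V W ((a + b) ⊗ₜ[ℂ] w)⁆
        rw [lie_add, TensorProduct.add_tmul, TensorProduct.add_tmul, TensorProduct.add_tmul,
          map_add, map_add, map_add, lie_add, ← ha, ← hb]
        abel
      | tmul u v =>
        change TensorProduct.assoc ℂ U V W (⁅x, u ⊗ₜ[ℂ] v⁆ ⊗ₜ[ℂ] w) +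
          TensorProduct.assoc ℂ U V W ((u ⊗ₜ[ℂ] v) ⊗ₜ[ℂ] ⁅x, w⁆) =
          ⁅x, u ⊗ₜ[ℂ] (v ⊗ₜ[ℂ] w)⁆
        simp only [TensorProduct.LieModule.lie_tmul_right, TensorProduct.add_tmul, map_add,
          TensorProduct.assoc_tmul, TensorProduct.tmul_add]
        abel }

/-- `ℂ ⊗ V ≅ V`, the usual isomorphism of vector spaces. -/
def lidEquiv (V : FDLieMod L) : tensor triv V ≃ₗ⁅ℂ,L⁆ V :=
  { (TensorProduct.lid ℂ V : _ ≃ₗ[ℂ] _) with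
    map_lie' := by
      intro x t
      refine map_lie_of_tmul (V := triv) (W := V) (X := V)
        (TensorProduct.lid ℂ V).toLinearMap ?_ x t
      intro x c v
      change (0 : ℂ) • v + (show ℂ from c) • ⁅x, v⁆ = ⁅x, (show ℂ from c) • v⁆
      rw [zero_smul, zero_add, lie_smul] }

/-- `V ⊗ ℂ ≅ V`, the usual isomorphism of vector spaces. -/
def ridEquiv (V : FDLieMod L) : tensor V triv ≃ₗ⁅ℂ,L⁆ V :=
  { (TensorProduct.rid ℂ V : _ ≃ₗ[ℂ] _) with
    map_lie' := by
      intro x t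
      refine map_lie_of_tmul (V := V) (W := triv) (X := V)
        (TensorProduct.rid ℂ V).toLinearMap ?_ x t
      intro x v c
      change (show ℂ from c) • ⁅x, v⁆ + (0 : ℂ) • v = ⁅x, (show ℂ from c) • v⁆
      rw [zero_smul, add_zero, lie_smul] }

instance : MonoidalCategoryStruct (FDLieMod L) where
  tensorObj := tensor
  whiskerLeft V {W X} f :=
    ofLie (V := tensor V W) (W := tensor V X)
      (TensorProduct.LieModule.map (LieModuleHom.id (M := V)) (toLie f))
  whiskerRight {V W} f X :=
    ofLie (V := tensor V X) (W := tensor W X)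
      (TensorProduct.LieModule.map (toLie f) (LieModuleHom.id (M := X)))
  tensorHom {V W X Y} f g :=
    ofLie (V := tensor V X) (W := tensor W Y)
      (TensorProduct.LieModule.map (toLie f) (toLie g))
  tensorUnit := triv
  associator U V W := isoOfEquiv (assocEquiv U V W)
  leftUnitor V := isoOfEquiv (lidEquiv V)
  rightUnitor V := isoOfEquiv (ridEquiv V)

/-- The pure tensor `v ⊗ w`, as an element of the object `V ⊗ W`. -/
def tmul {V W : FDLieMod L} (v : V) (w : W) : (V ⊗ W : FDLieMod L) :=
  (v ⊗ₜ[ℂ] w : TensorProduct ℂ V W)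

theorem tensor_induction {V W : FDLieMod L} {p : (V ⊗ W : FDLieMod L) → Prop}
    (zero : p 0) (tm : ∀ v w, p (tmul v w)) (add : ∀ a b, p a → p b → p (a + b)) (t) : p t :=
  TensorProduct.induction_on (motive := p) t zero tm add

theorem tensor_hom_ext {U V W : FDLieMod L} {f g : U ⊗ V ⟶ W}
    (h : ∀ (u : U) (v : V), toLie f (tmul u v) = toLie g (tmul u v)) : f = g :=
  hom_ext (tensor_induction (by simp) h fun a b ha hb => by simp only [map_add, ha, hb])

theorem tensor_hom_ext₃ {U V W X : FDLieMod L} {f g : (U ⊗ V) ⊗ W ⟶ X}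
    (h : ∀ u v w, toLie f (tmul (tmul u v) w) = toLie g (tmul (tmul u v) w)) : f = g := by
  refine tensor_hom_ext fun t w => ?_
  refine tensor_induction (p := fun t => toLie f (tmul t w) = toLie g (tmul t w)) ?_
    (fun u v => h u v w) ?_ t
  · rw [show tmul (0 : (U ⊗ V : FDLieMod L)) w = 0 from TensorProduct.zero_tmul _ _]
    simp
  · intro a b ha hb
    rw [show tmul (a + b) w = tmul a w + tmul b w from TensorProduct.add_tmul _ _ _]
    simp only [map_add, ha, hb]

theorem tensor_hom_ext₄ {U V W X Y : FDLieMod L} {f g : ((U ⊗ V) ⊗ W) ⊗ X ⟶ Y}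
    (h : ∀ u v w x, toLie f (tmul (tmul (tmul u v) w) x) =
      toLie g (tmul (tmul (tmul u v) w) x)) : f = g := by
  refine tensor_hom_ext₃ fun t w x => ?_
  refine tensor_induction
    (p := fun t => toLie f (tmul (tmul t w) x) = toLie g (tmul (tmul t w) x)) ?_
    (fun u v => h u v w x) ?_ t
  · rw [show tmul (0 : (U ⊗ V : FDLieMod L)) w = 0 from TensorProduct.zero_tmul _ _,
      show tmul (0 : ((U ⊗ V) ⊗ W : FDLieMod L)) x = 0 from TensorProduct.zero_tmul _ _]
    simp
  · intro a b ha hb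
    rw [show tmul (a + b) w = tmul a w + tmul b w from TensorProduct.add_tmul _ _ _,
      show tmul (tmul a w + tmul b w) x = tmul (tmul a w) x + tmul (tmul b w) x from
        TensorProduct.add_tmul _ _ _]
    simp only [map_add, ha, hb]

instance : MonoidalCategory (FDLieMod L) where
  tensorHom_def _ _ := tensor_hom_ext fun _ _ => rfl
  id_tensorHom_id _ _ := tensor_hom_ext fun _ _ => rfl
  tensorHom_comp_tensorHom _ _ _ _ := tensor_hom_ext fun _ _ => rfl
  whiskerLeft_id _ _ := tensor_hom_ext fun _ _ => rfl
  id_whiskerRight _ _ := tensor_hom_ext fun _ _ => rfl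
  associator_naturality _ _ _ := tensor_hom_ext₃ fun _ _ _ => rfl
  leftUnitor_naturality f := tensor_hom_ext fun c v =>
    (map_smul (toLie f) (show ℂ from c) v).symm
  rightUnitor_naturality f := tensor_hom_ext fun v c =>
    (map_smul (toLie f) (show ℂ from c) v).symm
  pentagon _ _ _ _ := tensor_hom_ext₄ fun _ _ _ _ => rfl
  triangle _ _ := tensor_hom_ext₃ fun v c w =>
    TensorProduct.tmul_smul (show ℂ from c) v w |>.trans
      (TensorProduct.smul_tmul' (show ℂ from c) v w)

end FDLieMod

/-! ### The Lie algebra `𝔰𝔩₃` and its natural module -/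

/-- The Lie algebra of traceless complex `3 × 3` matrices. -/
abbrev Sl3 : Type := LieAlgebra.SpecialLinear.sl (Fin 3) ℂ

/-- The monoidal category of finite dimensional `𝔰𝔩₃`-modules. -/
abbrev FinSl3 : Type 1 := FDLieMod Sl3

/-- The natural module `ℂ³`, matrices acting on column vectors. -/
def natF : FinSl3 where
  carrier := Fin 3 → ℂ

/-! ### Module categories -/

section ModuleCategories

attribute [local instance] hasBinaryBiproducts_of_finite_biproducts

variable (C : Type*) [Category* C] [MonoidalCategory C] [Preadditive C] [Linear ℂ C]
variable (M : Type*) [Category* M] [Preadditive M] [Linear ℂ M]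

/-- The action bifunctor `C × M ⥤ M` is `ℂ`-bilinear on morphisms. -/
class IsBilinearAction [MonoidalLeftAction C M] : Prop where
  actionHomRight_add (c : C) {X Y : M} (f g : X ⟶ Y) : c ⊴ₗ (f + g) = c ⊴ₗ f + c ⊴ₗ g
  actionHomRight_smul (c : C) {X Y : M} (r : ℂ) (f : X ⟶ Y) : c ⊴ₗ (r • f) = r • (c ⊴ₗ f)
  add_actionHomLeft {c d : C} (f g : c ⟶ d) (X : M) : (f + g) ⊵ₗ X = f ⊵ₗ X + g ⊵ₗ X
  smul_actionHomLeft {c d : C} (r : ℂ) (f : c ⟶ d) (X : M) : (r • f) ⊵ₗ X = r • (f ⊵ₗ X)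

/-- Isomorphism of indecomposable objects. -/
def indecSetoid [HasFiniteBiproducts M] : Setoid {X : M // Indecomposable X} :=
  (isIsomorphicSetoid M).comap Subtype.val

/-- Isomorphism classes of indecomposable objects. -/
def IndecClass [HasFiniteBiproducts M] : Type _ := Quotient (indecSetoid M)

variable {M} in
/-- A chosen representative of an isomorphism class of indecomposable objects. -/
def IndecClass.rep [HasFiniteBiproducts M] (i : IndecClass M) : M := (Quotient.out i).1

/-- Every object is a finite direct sum of objects with local endomorphism rings. -/
def IsKrullSchmidt [HasFiniteBiproducts M] : Prop :=
  ∀ X : M, ∃ (n : ℕ) (Y : Fin n → M), (∀ i, IsLocalRing (End (Y i))) ∧ Nonempty (X ≅ ⨁ Y)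

/-- The conditions on the underlying category of a locally finitary module category. -/
structure IsLocallyFinitary [HasFiniteBiproducts M] : Prop where
  idempotentComplete : IsIdempotentComplete M
  krullSchmidt : IsKrullSchmidt M
  countable : Countable (IndecClass M)
  finiteDimensional (X Y : M) : FiniteDimensional ℂ (X ⟶ Y)

/-- Admissible: locally finitary with weak kernels. -/
structure IsAdmissible [HasFiniteBiproducts M] : Prop extends IsLocallyFinitary M where
  hasWeakKernels : HasWeakKernels M

/-- A two-sided ideal of a `ℂ`-linear category. -/
structure CatIdeal where
  homs (X Y : M) : Submodule ℂ (X ⟶ Y)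
  precomp_mem {X Y Z : M} (g : X ⟶ Y) {f : Y ⟶ Z} (hf : f ∈ homs Y Z) : g ≫ f ∈ homs X Z
  postcomp_mem {X Y Z : M} {f : X ⟶ Y} (hf : f ∈ homs X Y) (g : Y ⟶ Z) : f ≫ g ∈ homs X Z

variable {M} in
/-- The ideal is stable under the action of all objects of `C`. -/
def CatIdeal.IsStable [MonoidalLeftAction C M] (I : CatIdeal M) : Prop :=
  ∀ (c : C) {X Y : M} (f : X ⟶ Y), f ∈ I.homs X Y → c ⊴ₗ f ∈ I.homs (c ⊙ₗ X) (c ⊙ₗ Y)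

/-- Simple: non-zero, and the only `C`-stable ideals are zero and the whole category. -/
structure IsSimpleModuleCategory [MonoidalLeftAction C M] : Prop where
  nonzero : ∃ X : M, ¬ IsZero X
  eq_bot_or_eq_top (I : CatIdeal M) (hI : I.IsStable C) :
    (∀ X Y : M, I.homs X Y = ⊥) ∨ (∀ X Y : M, I.homs X Y = ⊤)

variable {M} in
/-- The multiplicity of `X` as a direct summand of `Y`: the largest `n` such that `Xⁿ` is
a direct summand of `Y`. -/
def summandMultiplicity [HasFiniteBiproducts M] (X Y : M) : ℕ :=
  sSup {n : ℕ | ∃ Z : M, Nonempty (Y ≅ (⨁ fun _ : Fin n => X) ⊞ Z)}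

variable {C} in
/-- The action matrix `[c]`: its `(i, j)` entry is the multiplicity of `X_i` in `c X_j`. -/
def actionMatrix [HasFiniteBiproducts M] [MonoidalLeftAction C M] (c : C) :
    Matrix (IndecClass M) (IndecClass M) ℕ :=
  fun i j => summandMultiplicity i.rep (c ⊙ₗ j.rep)

/-- An oriented graph with vertex set `V` and finitely many edges from any vertex to any other:
`edges a b` is the number of edges from `a` to `b`. -/
structure OrientedMultigraph (V : Type*) where
  edges : V → V → ℕ

/-- Isomorphism of oriented graphs. -/
def OrientedMultigraph.Isomorphic {V W : Type*} (Γ : OrientedMultigraph V)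
    (Δ : OrientedMultigraph W) : Prop :=
  ∃ σ : V ≃ W, ∀ a b, Δ.edges (σ a) (σ b) = Γ.edges a b

variable {C} in
/-- The graph `Γ_c`, with `[c]_{i,j}` edges from `j` to `i`. -/
def actionGraph [HasFiniteBiproducts M] [MonoidalLeftAction C M] (c : C) :
    OrientedMultigraph (IndecClass M) where
  edges j i := actionMatrix M c i j

/-- Equivalence of `C`-module categories: a `ℂ`-linear functor that is an equivalence of
categories and carries the structure of a (strong) `C`-module functor. -/
def ModuleCategoriesEquivalent (N : Type*) [Category* N] [Preadditive N] [Linear ℂ N]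
    [MonoidalLeftAction C M] [MonoidalLeftAction C N] : Prop :=
  ∃ Φ : M ⥤ N, Φ.IsEquivalence ∧ Φ.Additive ∧ Φ.Linear ℂ ∧ Nonempty (Φ.LeftLinear C)

end ModuleCategories

/-- The graph of a module category over finite dimensional `𝔰𝔩₃`-modules. -/
def moduleGraph (M : Type*) [Category* M] [Preadditive M] [HasFiniteBiproducts M]
    [MonoidalLeftAction FinSl3 M] : OrientedMultigraph (IndecClass M) :=
  actionGraph M natF

/-- The dual graph of a module category over finite dimensional `𝔰𝔩₃`-modules. -/
def moduleDualGraph (M : Type*) [Category* M] [Preadditive M] [HasFiniteBiproducts M]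
    [MonoidalLeftAction FinSl3 M] : OrientedMultigraph (IndecClass M) :=
  actionGraph M natF.dual

end

/-!
Let `X` be the indecomposable object of `M` matching the unit object under the bijection `σ` of
vertices. Since the graphs agree, `F ⊗ⁿ X` decomposes like `F ⊗ⁿ 𝟙`, with vertices renamed by `σ`.
Every simple module is a summand of some `F ⊗ⁿ 𝟙`, and by rigidity no simple module kills `X`, so
counting indecomposable summands shows that `L ↦ L X` is a bijection from the simple modules to the
indecomposable objects of `M`.

The functor `c ↦ c X` is a module functor, so it remains to see that it is fully faithful, and by
duality it suffices to consider morphisms `r : k X ⟶ X` with `k` simple. If `r ≠ 0`, then simplicity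
of `M` provides a factorization of an automorphism of `X` as `X ⟶ l k X ⟶ l X ⟶ X` through `l r`
with `l` simple. All of `X`, `k X`, `l X` being indecomposable, this gives `X ≅ l X`, so `l` is the
unit and `r` is an isomorphism. Hence `Hom(k X, X) = 0` for `k` non-trivial, and `End X = ℂ`.

Two facts about `𝔰𝔩₃` are needed. Complete reducibility follows from the action of the Casimir
element. The natural module `F` generates because `F ⊗ⁿ 𝟙` contains primitive vectors of all
dominant weights, obtained by tensoring with `v₀` and with `v₀ ∧ v₁`, and a simple module embeds
into any module with a primitive vector of the same weight.
-/

noncomputable section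

attribute [local instance] hasBinaryBiproducts_of_finite_biproducts

/-! ### Objects with local endomorphism rings -/

section LocalObjects

variable {M : Type*} [Category* M] [Preadditive M]

theorem isIso_or_isIso_of_isIso_add {X Y : M} [IsLocalRing (End X)] {f g : X ⟶ Y} {b : Y ⟶ X}
    (h : IsIso ((f + g) ≫ b)) : IsIso (f ≫ b) ∨ IsIso (g ≫ b) := by
  have hadd : IsUnit ((show End X from f ≫ b) + (show End X from g ≫ b)) := by
    rw [isUnit_iff_isIso]
    exact Preadditive.add_comp X Y X f g b ▸ h
  simpa only [isUnit_iff_isIso] using IsLocalRing.isUnit_or_isUnit_of_isUnit_add hadd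

theorem not_isIso_zero_end (X : M) [IsLocalRing (End X)] : ¬ IsIso (0 : X ⟶ X) := fun h =>
  not_isUnit_zero ((isUnit_iff_isIso (0 : End X)).2 h)

theorem isIso_of_isIso_comp {X Y : M} [IsLocalRing (End X)] [IsLocalRing (End Y)]
    (a : X ⟶ Y) (b : Y ⟶ X) (h : IsIso (a ≫ b)) : IsIso a := by
  -- `e` is idempotent with `a ≫ e = a`, so `e = 𝟙` unless `a = 0`.
  let e : Y ⟶ Y := b ≫ inv (a ≫ b) ≫ a
  have ha : a ≫ e = a := by
    rw [← Category.assoc, IsIso.hom_inv_id_assoc]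
  have he : e ≫ e = e := by
    conv_lhs => rw [Category.assoc, Category.assoc, ha]
  have hsum : IsIso ((e + (𝟙 Y - e)) ≫ 𝟙 Y) := by
    rw [add_sub_cancel]; infer_instance
  rcases isIso_or_isIso_of_isIso_add hsum with h1 | h1 <;> rw [Category.comp_id] at h1
  · have he' : e = 𝟙 Y := by rw [← cancel_epi e, he, Category.comp_id]
    exact ⟨b ≫ inv (a ≫ b), by rw [← Category.assoc, IsIso.hom_inv_id],
      by rw [Category.assoc]; exact he'⟩
  · have ha' : a = 0 := by
      rw [← cancel_mono (𝟙 Y - e), Preadditive.comp_sub, ha, Category.comp_id, sub_self, zero_comp]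
    rw [ha', zero_comp] at h
    exact (not_isIso_zero_end X h).elim

theorem isLocalRing_end_of_iso {X Y : M} (e : X ≅ Y) [IsLocalRing (End X)] :
    IsLocalRing (End Y) where
  toNontrivial := e.conj.symm.toEquiv.nontrivial
  isUnit_or_isUnit_of_add_one {f g} h := by
    have hfg : (show Y ⟶ Y from f) + (show Y ⟶ Y from g) = 𝟙 Y := h
    have hsum : IsIso ((e.hom ≫ (show Y ⟶ Y from f) + e.hom ≫ (show Y ⟶ Y from g)) ≫ e.inv) := by
      rw [← Preadditive.comp_add, hfg, Category.comp_id, e.hom_inv_id]; infer_instance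
    rw [isUnit_iff_isIso, isUnit_iff_isIso]
    simpa only [isIso_comp_right_iff, isIso_comp_left_iff] using isIso_or_isIso_of_isIso_add hsum

variable [HasFiniteBiproducts M]

theorem indecomposable_of_isLocalRing_end (X : M) [IsLocalRing (End X)] : Indecomposable X := by
  refine ⟨fun h => not_isIso_zero_end X ⟨0, h.eq_of_src _ _, h.eq_of_src _ _⟩, fun Y Z e => ?_⟩
  have := isLocalRing_end_of_iso e
  have htotal : IsIso (((biprod.fst : Y ⊞ Z ⟶ Y) ≫ biprod.inl +
      (biprod.snd : Y ⊞ Z ⟶ Z) ≫ biprod.inr) ≫ 𝟙 (Y ⊞ Z)) := by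
    rw [biprod.total]; infer_instance
  rcases isIso_or_isIso_of_isIso_add htotal with h | h <;> rw [Category.comp_id] at h
  · have := mono_of_mono (biprod.fst : Y ⊞ Z ⟶ Y) (biprod.inl : Y ⟶ Y ⊞ Z)
    have hinr : (biprod.inr : Z ⟶ Y ⊞ Z) = 0 := by
      rw [← cancel_mono biprod.fst, biprod.inr_fst, zero_comp]
    exact Or.inr ((IsZero.iff_id_eq_zero Z).2 (by
      rw [← (biprod.inr_snd : biprod.inr ≫ (biprod.snd : Y ⊞ Z ⟶ Z) = _), hinr, zero_comp]))
  · have := mono_of_mono (biprod.snd : Y ⊞ Z ⟶ Z) (biprod.inr : Z ⟶ Y ⊞ Z)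
    have hinl : (biprod.inl : Y ⟶ Y ⊞ Z) = 0 := by
      rw [← cancel_mono biprod.snd, biprod.inl_snd, zero_comp]
    exact Or.inl ((IsZero.iff_id_eq_zero Y).2 (by
      rw [← (biprod.inl_fst : biprod.inl ≫ (biprod.fst : Y ⊞ Z ⟶ Y) = _), hinl, zero_comp]))

/-- A biproduct over `Fin (n + 1)` splits off its first summand. -/
def biproductFinSuccIso {n : ℕ} (Y : Fin (n + 1) → M) :
    (⨁ Y) ≅ Y 0 ⊞ (⨁ fun k : Fin n => Y k.succ) where
  hom := biprod.lift (biproduct.π Y 0) (biproduct.lift fun k => biproduct.π Y k.succ)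
  inv := biprod.desc (biproduct.ι Y 0) (biproduct.desc fun k => biproduct.ι Y k.succ)
  hom_inv_id := by
    rw [biprod.lift_desc, biproduct.lift_desc, ← biproduct.total, Fin.sum_univ_succ]
  inv_hom_id := by
    ext
    · simp
    · simp [(Fin.succ_ne_zero _).symm]
    · simp [Fin.succ_ne_zero]
    · simp [biproduct.ι_π]

theorem isZero_biproduct_fin_zero (Y : Fin 0 → M) : IsZero (⨁ Y) := by
  rw [IsZero.iff_id_eq_zero]
  exact biproduct.hom_ext _ _ fun j => j.elim0

end LocalObjects

/-! ### Multiplicities in Krull–Schmidt categories -/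

section Multiplicity

variable {M : Type*} [Category* M] [Preadditive M] [Linear ℂ M]

/-- The radical morphisms out of an object with local endomorphism ring: those that are not
split monomorphisms. They form a subspace because non-units of a local ring are closed under
addition. -/
def radHom (X Y : M) [IsLocalRing (End X)] : Submodule ℂ (X ⟶ Y) where
  carrier := {f | ∀ g : Y ⟶ X, ¬ IsIso (f ≫ g)}
  zero_mem' g := by rw [zero_comp]; exact not_isIso_zero_end X
  add_mem' {_ _} ha hb g h := (isIso_or_isIso_of_isIso_add h).elim (ha g) (hb g)
  smul_mem' c f hf g h := hf (c • g) (by rwa [Linear.comp_smul, ← Linear.smul_comp])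

theorem comp_mem_radHom {X Y Z : M} [IsLocalRing (End X)] {f : X ⟶ Y} (hf : f ∈ radHom X Y)
    (g : Y ⟶ Z) : f ≫ g ∈ radHom X Z := fun k => by
  rw [Category.assoc]; exact hf _

theorem radHom_eq_top_iff_isEmpty_retract {X Y : M} [IsLocalRing (End X)] :
    radHom X Y = ⊤ ↔ IsEmpty (Retract X Y) := by
  refine ⟨fun h => ⟨fun r => ?_⟩, fun h => eq_top_iff.2 fun f _ g hfg => ?_⟩
  · have hr : r.i ∈ radHom X Y := h ▸ Submodule.mem_top
    exact hr r.r (r.retract ▸ inferInstance)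
  · exact h.elim ⟨f, g ≫ inv (f ≫ g), by rw [← Category.assoc, IsIso.hom_inv_id]⟩

/-- The multiplicity of an object `X` with local endomorphism ring in another object, as the
dimension of the space of morphisms out of `X` modulo radical morphisms. This is the
multiplicity as a summand because the residue field of `End X` is `ℂ`. -/
def localMult (X Y : M) [IsLocalRing (End X)] : ℕ := Module.finrank ℂ ((X ⟶ Y) ⧸ radHom X Y)

theorem localMult_congr {X Y Z : M} [IsLocalRing (End X)] (e : Y ≅ Z) :
    localMult X Y = localMult X Z := by
  refine (Submodule.Quotient.equiv (radHom X Y) (radHom X Z)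
    (Linear.homCongr ℂ (Iso.refl X) e) ?_).finrank_eq
  ext f
  constructor
  · rintro ⟨g, hg, rfl⟩
    simpa [Linear.homCongr_apply] using comp_mem_radHom hg e.hom
  · exact fun hf => ⟨f ≫ e.inv, comp_mem_radHom hf e.inv, by simp [Linear.homCongr_apply]⟩

theorem localMult_eq_zero_of_isEmpty_retract {X Y : M} [IsLocalRing (End X)]
    (h : IsEmpty (Retract X Y)) : localMult X Y = 0 := by
  rw [localMult, radHom_eq_top_iff_isEmpty_retract.2 h]
  exact Module.finrank_zero_of_subsingleton

theorem localMult_of_isZero {X Y : M} [IsLocalRing (End X)] (h : IsZero Y) :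
    localMult X Y = 0 :=
  localMult_eq_zero_of_isEmpty_retract ⟨fun r => not_isIso_zero_end X
    (by rw [← zero_comp (f := r.r), h.eq_of_tgt 0 r.i, r.retract]; infer_instance)⟩

section FiniteHoms

variable [hfd : ∀ X Y : M, Module.Finite ℂ (X ⟶ Y)]

theorem exists_not_isIso_sub_smul (X : M) [Nontrivial (End X)] (f : X ⟶ X) :
    ∃ c : ℂ, ¬ IsIso (f - c • 𝟙 X) := by
  have : FiniteDimensional ℂ (End X) := hfd X X
  obtain ⟨c, hc⟩ := spectrum.nonempty_of_isAlgClosed_of_finiteDimensional ℂ (show End X from f)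
  refine ⟨c, fun h => hc ?_⟩
  rw [spectrum.mem_resolventSet_iff, ← IsUnit.neg_iff, neg_sub, isUnit_iff_isIso,
    Algebra.algebraMap_eq_smul_one]
  exact h

theorem localMult_self (X : M) [IsLocalRing (End X)] : localMult X X = 1 := by
  refine finrank_eq_one (Submodule.Quotient.mk (𝟙 X)) ?_ ?_
  · rw [Ne, Submodule.Quotient.mk_eq_zero]
    exact fun h => h (𝟙 X) (by rw [Category.comp_id]; infer_instance)
  · intro w
    obtain ⟨f, rfl⟩ := Submodule.Quotient.mk_surjective _ w
    obtain ⟨c, hc⟩ := exists_not_isIso_sub_smul X f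
    refine ⟨c, ?_⟩
    rw [← Submodule.Quotient.mk_smul, eq_comm, Submodule.Quotient.eq]
    exact fun g hg => hc (isIso_of_isIso_comp _ g hg)

variable [HasFiniteBiproducts M]

theorem localMult_biprod (X Y Z : M) [IsLocalRing (End X)] :
    localMult X (Y ⊞ Z) = localMult X Y + localMult X Z := by
  let φ : (X ⟶ Y ⊞ Z) →ₗ[ℂ] ((X ⟶ Y) ⧸ radHom X Y) × ((X ⟶ Z) ⧸ radHom X Z) :=
    LinearMap.prod ((radHom X Y).mkQ ∘ₗ Linear.rightComp ℂ X (biprod.fst : Y ⊞ Z ⟶ Y))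
      ((radHom X Z).mkQ ∘ₗ Linear.rightComp ℂ X (biprod.snd : Y ⊞ Z ⟶ Z))
  have hφ : Function.Surjective φ := by
    rintro ⟨y, z⟩
    obtain ⟨f, rfl⟩ := Submodule.Quotient.mk_surjective _ y
    obtain ⟨g, rfl⟩ := Submodule.Quotient.mk_surjective _ z
    exact ⟨biprod.lift f g, by simp [φ]⟩
  have hker : LinearMap.ker φ = radHom X (Y ⊞ Z) := by
    ext f
    simp only [φ, LinearMap.mem_ker, LinearMap.prod_apply, Function.prod, Prod.mk_eq_zero,
      LinearMap.comp_apply, Submodule.mkQ_apply, Submodule.Quotient.mk_eq_zero,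
      Linear.rightComp_apply]
    refine ⟨fun ⟨hY, hZ⟩ g hg => ?_, fun h => ⟨comp_mem_radHom h _, comp_mem_radHom h _⟩⟩
    have hsum : IsIso ((f ≫ biprod.fst ≫ biprod.inl + f ≫ biprod.snd ≫ biprod.inr) ≫ g) := by
      rwa [← Preadditive.comp_add, biprod.total, Category.comp_id]
    rcases isIso_or_isIso_of_isIso_add hsum with h | h
    · exact hY (biprod.inl ≫ g) (by simpa using h)
    · exact hZ (biprod.inr ≫ g) (by simpa using h)
  rw [localMult, ← hker, (φ.quotKerEquivOfSurjective hφ).finrank_eq, Module.finrank_prod]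
  rfl

theorem localMult_biproduct_const (X : M) [IsLocalRing (End X)] (n : ℕ) :
    localMult X (⨁ fun _ : Fin n => X) = n := by
  induction n with
  | zero => exact localMult_of_isZero (isZero_biproduct_fin_zero _)
  | succ n ih =>
    rw [localMult_congr (biproductFinSuccIso _), localMult_biprod, localMult_self, ih, add_comm]

end FiniteHoms

end Multiplicity

section KrullSchmidt

variable {M : Type*} [Category* M] [Preadditive M] [HasFiniteBiproducts M]

theorem IndecClass.indecomposable_rep (i : IndecClass M) : Indecomposable i.rep :=
  (Quotient.out i).2

theorem IndecClass.eq_of_iso {i j : IndecClass M} (e : i.rep ≅ j.rep) : i = j :=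
  Quotient.out_equiv_out.1 (show (indecSetoid M) _ _ from ⟨e⟩)

theorem IndecClass.exists_iso {X : M} (hX : Indecomposable X) :
    ∃ i : IndecClass M, Nonempty (X ≅ i.rep) :=
  ⟨Quotient.mk (indecSetoid M) ⟨X, hX⟩,
    (indecSetoid M).symm (Quotient.mk_out (s := indecSetoid M) ⟨X, hX⟩)⟩

variable [hks : Fact (IsKrullSchmidt M)]

theorem isLocalRing_end_of_indecomposable {X : M} (hX : Indecomposable X) :
    IsLocalRing (End X) := by
  obtain ⟨n, Y, hY, ⟨e⟩⟩ := hks.out X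
  rcases n with _ | n
  · exact (hX.1 ((isZero_biproduct_fin_zero Y).of_iso e)).elim
  · have := hY 0
    rcases hX.2 _ _ (e ≪≫ biproductFinSuccIso Y) with h | h
    · exact ((indecomposable_of_isLocalRing_end (Y 0)).1 h).elim
    · exact isLocalRing_end_of_iso (isoBiprodZero h ≪≫ (biproductFinSuccIso Y).symm ≪≫ e.symm)

instance (i : IndecClass M) : IsLocalRing (End i.rep) :=
  isLocalRing_end_of_indecomposable i.indecomposable_rep

theorem krullSchmidt_induction {P : M → Prop} (iso : ∀ X Y, (X ≅ Y) → P X → P Y)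
    (zero : ∀ X, IsZero X → P X) (add : ∀ (i : IndecClass M) Y, P Y → P (i.rep ⊞ Y)) (X : M) :
    P X := by
  obtain ⟨n, Y, hY, ⟨e⟩⟩ := hks.out X
  refine iso _ _ e.symm ?_
  clear e
  induction n with
  | zero => exact zero _ (isZero_biproduct_fin_zero Y)
  | succ n ih =>
    have := hY 0
    obtain ⟨i, ⟨f⟩⟩ := IndecClass.exists_iso (indecomposable_of_isLocalRing_end (Y 0))
    exact iso _ _ (biprod.mapIso f.symm (Iso.refl _) ≪≫ (biproductFinSuccIso Y).symm)
      (add i _ (ih _ fun k => hY k.succ))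

variable [Linear ℂ M] [hfd : ∀ X Y : M, Module.Finite ℂ (X ⟶ Y)]

theorem localMult_rep_rep [DecidableEq (IndecClass M)] (i j : IndecClass M) :
    localMult i.rep j.rep = if j = i then 1 else 0 := by
  split_ifs with h
  · subst h; exact localMult_self _
  · refine localMult_eq_zero_of_isEmpty_retract ⟨fun r => h (IndecClass.eq_of_iso ?_)⟩
    have := isIso_of_isIso_comp r.i r.r (r.retract ▸ inferInstance)
    exact (asIso r.i).symm

theorem finite_support_localMult (Y : M) :
    (Function.support fun i : IndecClass M => localMult i.rep Y).Finite := by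
  classical
  induction Y using krullSchmidt_induction with
  | iso X Y e h => simpa only [localMult_congr e] using h
  | zero X h => simp [localMult_of_isZero h]
  | add i Y h =>
    refine (h.union (Set.finite_singleton i)).subset fun j hj => ?_
    simp only [Function.mem_support, localMult_biprod, localMult_rep_rep] at hj
    by_cases hij : i = j
    · exact Or.inr hij.symm
    · exact Or.inl (by simpa [hij] using hj)

/-- The multiplicities of all indecomposable objects in a given object. -/
def indecMult (Y : M) : IndecClass M →₀ ℕ :=
  Finsupp.ofSupportFinite (fun i => localMult i.rep Y) (finite_support_localMult Y)

theorem indecMult_apply (Y : M) (i : IndecClass M) : indecMult Y i = localMult i.rep Y := rfl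

theorem indecMult_congr {Y Z : M} (e : Y ≅ Z) : indecMult Y = indecMult Z :=
  Finsupp.ext fun _ => localMult_congr e

theorem indecMult_of_isZero {Y : M} (h : IsZero Y) : indecMult Y = 0 :=
  Finsupp.ext fun _ => localMult_of_isZero h

theorem indecMult_biprod (Y Z : M) : indecMult (Y ⊞ Z) = indecMult Y + indecMult Z :=
  Finsupp.ext fun _ => localMult_biprod _ _ _

theorem indecMult_rep (i : IndecClass M) : indecMult i.rep = Finsupp.single i 1 := by
  classical
  exact Finsupp.ext fun j => by
    rw [indecMult_apply, localMult_rep_rep, Finsupp.single_apply]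

theorem isZero_of_indecMult_eq_zero {Y : M} (h : indecMult Y = 0) : IsZero Y := by
  revert h
  induction Y using krullSchmidt_induction with
  | iso X Y e h => rw [← indecMult_congr e]; exact fun hx => (h hx).of_iso e.symm
  | zero X h => exact fun _ => h
  | add j Y _ =>
    rw [indecMult_biprod, indecMult_rep]
    exact fun h0 => absurd (DFunLike.congr_fun h0 j) (by simp)

theorem nonempty_iso_of_indecMult_eq_single {Y : M} {i : IndecClass M}
    (h : indecMult Y = Finsupp.single i 1) : Nonempty (Y ≅ i.rep) := by
  revert h
  induction Y using krullSchmidt_induction with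
  | iso X Y e h =>
    rw [← indecMult_congr e]
    exact fun hi => (h hi).map fun f => e.symm ≪≫ f
  | zero X h =>
    intro hi
    rw [indecMult_of_isZero h] at hi
    exact absurd (DFunLike.congr_fun hi i) (by simp)
  | add j Y _ =>
    rw [indecMult_biprod, indecMult_rep]
    intro hi
    obtain rfl : i = j := by
      by_contra hne
      have hj := DFunLike.congr_fun hi j
      rw [Finsupp.single_eq_of_ne (Ne.symm hne)] at hj
      simp at hj
    exact ⟨(isoBiprodZero (isZero_of_indecMult_eq_zero (by simpa using hi))).symm⟩

theorem indecMult_ne_zero_iff_nonempty_retract {Y : M} {i : IndecClass M} :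
    indecMult Y i ≠ 0 ↔ Nonempty (Retract i.rep Y) := by
  rw [indecMult_apply, localMult, Ne, Module.finrank_zero_iff,
    Submodule.Quotient.subsingleton_iff, radHom_eq_top_iff_isEmpty_retract, not_isEmpty_iff]

theorem exists_iso_biproduct_localMult (i : IndecClass M) (Y : M) :
    ∃ Z : M, Nonempty (Y ≅ (⨁ fun _ : Fin (localMult i.rep Y) => i.rep) ⊞ Z) := by
  classical
  induction Y using krullSchmidt_induction with
  | iso X Y e h =>
    rw [← localMult_congr e]
    obtain ⟨Z, ⟨f⟩⟩ := h
    exact ⟨Z, ⟨e.symm ≪≫ f⟩⟩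
  | zero X h =>
    rw [localMult_of_isZero h]
    exact ⟨X, ⟨isoZeroBiprod (isZero_biproduct_fin_zero _)⟩⟩
  | add j Y h =>
    obtain ⟨Z, ⟨f⟩⟩ := h
    by_cases hji : j = i
    · subst hji
      rw [localMult_biprod, localMult_self, add_comm]
      exact ⟨Z, ⟨biprod.mapIso (Iso.refl _) f ≪≫ (biprod.associator _ _ _).symm ≪≫
        biprod.mapIso (biproductFinSuccIso fun _ => j.rep).symm (Iso.refl _)⟩⟩
    · rw [localMult_biprod, localMult_rep_rep, if_neg hji, zero_add]
      exact ⟨j.rep ⊞ Z, ⟨biprod.mapIso (Iso.refl _) f ≪≫ (biprod.associator _ _ _).symm ≪≫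
        biprod.mapIso (biprod.braiding _ _) (Iso.refl _) ≪≫ biprod.associator _ _ _⟩⟩

theorem summandMultiplicity_rep (i : IndecClass M) (Y : M) :
    summandMultiplicity i.rep Y = indecMult Y i := by
  refine IsGreatest.csSup_eq ⟨exists_iso_biproduct_localMult i Y, ?_⟩
  rintro n ⟨Z, ⟨e⟩⟩
  rw [indecMult_apply, localMult_congr e, localMult_biprod, localMult_biproduct_const]
  exact Nat.le_add_right _ _

end KrullSchmidt

/-! ### Additive functors between Krull–Schmidt categories -/

section KrullSchmidtFunctor

variable {C M : Type*} [Category* C] [Preadditive C] [HasFiniteBiproducts C]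
  [Category* M] [Preadditive M] (Φ : C ⥤ M) [Φ.Additive]

theorem map_fst_inl_add_map_snd_inr (A B : C) :
    Φ.map (biprod.fst : A ⊞ B ⟶ A) ≫ Φ.map biprod.inl +
      Φ.map (biprod.snd : A ⊞ B ⟶ B) ≫ Φ.map biprod.inr = 𝟙 (Φ.obj (A ⊞ B)) := by
  rw [← Φ.map_comp, ← Φ.map_comp, ← Φ.map_add, biprod.total, Φ.map_id]

theorem map_bijective_of_rep [Fact (IsKrullSchmidt C)] {W : C}
    (h : ∀ i : IndecClass C, Function.Bijective (Φ.map : (i.rep ⟶ W) → (Φ.obj i.rep ⟶ Φ.obj W)))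
    (V : C) : Function.Bijective (Φ.map : (V ⟶ W) → (Φ.obj V ⟶ Φ.obj W)) := by
  induction V using krullSchmidt_induction with
  | iso X Y e hX =>
    refine ⟨fun f g hfg => ?_, fun r => ?_⟩
    · rw [← cancel_epi e.hom]
      exact hX.1 (by rw [Φ.map_comp, Φ.map_comp, hfg])
    · obtain ⟨f, hf⟩ := hX.2 (Φ.map e.hom ≫ r)
      exact ⟨e.inv ≫ f, by rw [Φ.map_comp, hf, ← Category.assoc, ← Φ.map_comp, e.inv_hom_id,
        Φ.map_id, Category.id_comp]⟩
  | zero X hX =>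
    exact ⟨fun f g _ => hX.eq_of_src f g, fun r => ⟨0, (Φ.map_isZero hX).eq_of_src _ r⟩⟩
  | add i Y hY =>
    refine ⟨fun f g hfg => biprod.hom_ext' _ _ ((h i).1 ?_) (hY.1 ?_), fun r => ?_⟩
    · rw [Φ.map_comp, Φ.map_comp, hfg]
    · rw [Φ.map_comp, Φ.map_comp, hfg]
    · obtain ⟨u, hu⟩ := (h i).2 (Φ.map biprod.inl ≫ r)
      obtain ⟨v, hv⟩ := hY.2 (Φ.map biprod.inr ≫ r)
      refine ⟨biprod.fst ≫ u + biprod.snd ≫ v, ?_⟩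
      rw [Φ.map_add, Φ.map_comp, Φ.map_comp, hu, hv, ← Category.assoc, ← Category.assoc,
        ← Preadditive.add_comp, map_fst_inl_add_map_snd_inr, Category.id_comp]

variable [HasFiniteBiproducts M] [Fact (IsKrullSchmidt M)]

attribute [local instance] preservesBinaryBiproducts_of_preservesBiproducts

theorem essSurj_of_rep (h : ∀ j : IndecClass M, ∃ V : C, Nonempty (Φ.obj V ≅ j.rep)) :
    Φ.EssSurj where
  mem_essImage Y := by
    induction Y using krullSchmidt_induction with
    | iso X Y e hX => exact Functor.essImage.ofIso e hX
    | zero X hX =>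
      exact ⟨⨁ (Fin.elim0 : Fin 0 → C),
        ⟨(Φ.map_isZero (isZero_biproduct_fin_zero Fin.elim0)).iso hX⟩⟩
    | add j Y hY =>
      obtain ⟨V, ⟨e⟩⟩ := h j
      obtain ⟨W, ⟨f⟩⟩ := hY
      exact ⟨V ⊞ W, ⟨Φ.mapBiprod V W ≪≫ biprod.mapIso e f⟩⟩

variable [Fact (IsKrullSchmidt C)] [Linear ℂ C] [∀ X Y : C, Module.Finite ℂ (X ⟶ Y)]
  [Linear ℂ M] [∀ X Y : M, Module.Finite ℂ (X ⟶ Y)]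

theorem indecMult_functor (Y : C) :
    indecMult (Φ.obj Y) = (indecMult Y).sum fun i k => k • indecMult (Φ.obj i.rep) := by
  induction Y using krullSchmidt_induction with
  | iso X Y e h => rw [← indecMult_congr e, ← indecMult_congr (Φ.mapIso e), h]
  | zero X h =>
    rw [indecMult_of_isZero h, indecMult_of_isZero (Φ.map_isZero h), Finsupp.sum_zero_index]
  | add i Y h =>
    rw [indecMult_congr (Φ.mapBiprod _ _), indecMult_biprod, indecMult_biprod, indecMult_rep,
      Finsupp.sum_add_index' (by simp) (fun _ _ _ => add_smul _ _ _), h,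
      Finsupp.sum_single_index (by simp), one_smul]

theorem indecMult_functor_of_single {π : IndecClass C → IndecClass M}
    (hπ : ∀ i, indecMult (Φ.obj i.rep) = Finsupp.single (π i) 1) (V : C) :
    indecMult (Φ.obj V) = (indecMult V).mapDomain π := by
  rw [indecMult_functor, Finsupp.mapDomain]
  refine Finsupp.sum_congr fun i _ => ?_
  rw [hπ, Finsupp.smul_single, smul_eq_mul, mul_one]

end KrullSchmidtFunctor

/-! ### The action functors -/

section Action

open MonoidalLeftAction Category

variable {C : Type*} [Category* C] [MonoidalCategory C]
variable {M : Type*} [Category* M] [MonoidalLeftAction C M]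

variable (M) in
/-- The functor `X ↦ c X`, the action of a fixed object `c`. -/
def actLeft (c : C) : M ⥤ M where
  obj X := c ⊙ₗ X
  map f := c ⊴ₗ f

variable (C) in
/-- The functor `c ↦ c X`, the action on a fixed object `X`. -/
def actRight (X : M) : C ⥤ M where
  obj c := c ⊙ₗ X
  map f := f ⊵ₗ X

instance actRightLeftLinear (X : M) : (actRight C X).LeftLinear C where
  μₗ c d := (αₗ c d X).inv
  δₗ c d := (αₗ c d X).hom
  μₗ_naturality_left f d := by
    change f ⊵ₗ (d ⊙ₗ X) ≫ _ = _ ≫ (f ▷ d) ⊵ₗ X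
    simp
  μₗ_naturality_right c _ _ f := by
    change c ⊴ₗ (f ⊵ₗ X) ≫ _ = _ ≫ (c ◁ f) ⊵ₗ X
    simp
  μₗ_associativity c c' d := by
    change (αₗ (c ⊗ c') d X).inv ≫ (α_ c c' d).hom ⊵ₗ X =
      (αₗ c c' (d ⊙ₗ X)).hom ≫ c ⊴ₗ (αₗ c' d X).inv ≫ (αₗ c (c' ⊗ d) X).inv
    rw [Iso.inv_comp_eq, ← assoc, ← assoc, Iso.eq_comp_inv, ← cancel_mono (c ⊴ₗ (αₗ c' d X).hom)]
    simp
  μₗ_unitality d := by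
    change (λₗ (d ⊙ₗ X)).hom = (αₗ (𝟙_ C) d X).inv ≫ (λ_ d).hom ⊵ₗ X
    simp
  δₗ_naturality_left f d := by
    change (f ▷ d) ⊵ₗ X ≫ _ = _ ≫ f ⊵ₗ (d ⊙ₗ X)
    simp
  δₗ_naturality_right c _ _ f := by
    change (c ◁ f) ⊵ₗ X ≫ _ = _ ≫ c ⊴ₗ (f ⊵ₗ X)
    simp
  δₗ_associativity c c' d := (associator_actionHom c c' d X).symm
  δₗ_unitality_inv d := by
    change (λₗ (d ⊙ₗ X)).inv = (λ_ d).inv ⊵ₗ X ≫ (αₗ (𝟙_ C) d X).hom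
    rw [← cancel_mono (λₗ (d ⊙ₗ X)).hom, assoc, ← leftUnitor_actionHom]
    simp only [Iso.inv_hom_id]
    exact (inv_hom_actionHomLeft (λ_ d) X).symm
  μₗ_comp_δₗ c d := (αₗ c d X).inv_hom_id
  δₗ_comp_μₗ c d := (αₗ c d X).hom_inv_id

theorem associator_inv_actionHomLeft (a b c : C) (X : M) :
    (αₗ a b (c ⊙ₗ X)).inv ≫ (αₗ (a ⊗ b) c X).inv =
      a ⊴ₗ (αₗ b c X).inv ≫ (αₗ a (b ⊗ c) X).inv ≫ (α_ a b c).inv ⊵ₗ X := by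
  rw [← IsIso.inv_eq_inv]
  simp

theorem act_coevaluation_evaluation (Y Y' : C) [ExactPairing Y Y'] (A : M) :
    Y' ⊴ₗ ((λₗ[C] A).inv ≫ η_ Y Y' ⊵ₗ A ≫ (αₗ Y Y' A).hom) ≫
      (αₗ Y' Y (Y' ⊙ₗ A)).inv ≫ ε_ Y Y' ⊵ₗ (Y' ⊙ₗ A) ≫ (λₗ[C] (Y' ⊙ₗ A)).hom = 𝟙 _ := by
  have h := congrArg (· ⊵ₗ A) (ExactPairing.coevaluation_evaluation Y Y')
  simp only [comp_actionHomLeft, whiskerLeft_actionHomLeft, rightUnitor_actionHom,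
    Category.assoc, Iso.cancel_iso_hom_left] at h
  simp only [actionHomRight_comp, actionHomLeft_action, Category.assoc,
    reassoc_of% associator_inv_actionHomLeft, actionHomRight_hom_inv_assoc]
  rw [reassoc_of% h, ← leftUnitor_actionHom, inv_hom_actionHomLeft, Category.comp_id,
    actionHomRight_inv_hom]

theorem act_evaluation_coevaluation (Y Y' : C) [ExactPairing Y Y'] (B : M) :
    (λₗ[C] (Y ⊙ₗ B)).inv ≫ η_ Y Y' ⊵ₗ (Y ⊙ₗ B) ≫ (αₗ Y Y' (Y ⊙ₗ B)).hom ≫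
      Y ⊴ₗ ((αₗ Y' Y B).inv ≫ ε_ Y Y' ⊵ₗ B ≫ (λₗ[C] B).hom) = 𝟙 _ := by
  have h := congrArg (· ⊵ₗ B) (ExactPairing.evaluation_coevaluation Y Y')
  simp only [comp_actionHomLeft, whiskerLeft_actionHomLeft, leftUnitor_actionHom,
    Category.assoc] at h
  rw [← cancel_mono (αₗ Y (𝟙_ C) B).hom] at h
  simp only [Category.assoc, Iso.inv_hom_id, Category.comp_id] at h
  simp only [actionHomRight_comp, actionHomLeft_action, Category.assoc]
  rw [← associator_actionHom_assoc, actionHomRight_hom_inv_assoc, reassoc_of% h,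
    Iso.inv_hom_id_assoc, Iso.inv_hom_id_assoc, ← rightUnitor_actionHom, inv_hom_actionHomLeft]

/-- The action of a dual of `Y` is left adjoint to the action of `Y`. -/
def actLeftHomEquiv (Y Y' : C) [ExactPairing Y Y'] (A B : M) :
    (Y' ⊙ₗ A ⟶ B) ≃ (A ⟶ Y ⊙ₗ B) where
  toFun g := (λₗ[C] A).inv ≫ η_ Y Y' ⊵ₗ A ≫ (αₗ Y Y' A).hom ≫ Y ⊴ₗ g
  invFun f := Y' ⊴ₗ f ≫ (αₗ Y' Y B).inv ≫ ε_ Y Y' ⊵ₗ B ≫ (λₗ[C] B).hom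
  left_inv g := by
    have hg : Y' ⊴ₗ Y ⊴ₗ g ≫ (αₗ Y' Y B).inv ≫ ε_ Y Y' ⊵ₗ B ≫ (λₗ[C] B).hom =
        (αₗ Y' Y (Y' ⊙ₗ A)).inv ≫ ε_ Y Y' ⊵ₗ (Y' ⊙ₗ A) ≫ (λₗ[C] (Y' ⊙ₗ A)).hom ≫ g := by
      rw [actionUnitIso_hom_naturality, ← action_exchange_assoc]
      simp
    have htriangle := act_coevaluation_evaluation Y Y' A =≫ g
    simp only [Category.assoc, actionHomRight_comp, Category.id_comp] at htriangle ⊢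
    rw [hg, htriangle]
  right_inv f := by
    have hf : (λₗ[C] A).inv ≫ η_ Y Y' ⊵ₗ A ≫ (αₗ Y Y' A).hom ≫ Y ⊴ₗ Y' ⊴ₗ f =
        f ≫ (λₗ[C] (Y ⊙ₗ B)).inv ≫ η_ Y Y' ⊵ₗ (Y ⊙ₗ B) ≫ (αₗ Y Y' (Y ⊙ₗ B)).hom := by
      rw [← actionUnitIso_inv_naturality_assoc, action_exchange_assoc]
      simp
    have htriangle := f ≫= act_evaluation_coevaluation Y Y' B
    simp only [Category.comp_id] at htriangle
    simp only [actionHomRight_comp _ (Y' ⊴ₗ f), reassoc_of% hf, htriangle]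

theorem actLeftHomEquiv_actionHomLeft (Y Y' : C) [ExactPairing Y Y'] {V U : C}
    (f : Y' ⊗ V ⟶ U) (X : M) :
    actLeftHomEquiv Y Y' (V ⊙ₗ X) (U ⊙ₗ X) ((αₗ Y' V X).inv ≫ f ⊵ₗ X) =
      tensorLeftHomEquiv V Y Y' U f ⊵ₗ X ≫ (αₗ Y U X).hom := by
  simp only [actLeftHomEquiv, tensorLeftHomEquiv, Equiv.coe_fn_mk, comp_actionHomLeft,
    whiskerLeft_actionHomLeft, Category.assoc, Iso.inv_hom_id, Category.comp_id,
    actionHomRight_comp, actionHomLeft_action]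
  rw [← associator_actionHom_assoc, actionHomRight_hom_inv_assoc]
  have : (λₗ[C] (V ⊙ₗ X)).inv ≫ (αₗ (𝟙_ C) V X).inv = (λ_ V).inv ⊵ₗ X := by
    rw [← IsIso.inv_eq_inv]
    simp
  rw [reassoc_of% this]

theorem actionHomLeft_bijective_of_exactPairing (X : M) (Y Y' : C) [ExactPairing Y Y'] {V U : C}
    (h : Function.Bijective fun f : Y' ⊗ V ⟶ U => f ⊵ₗ X) :
    Function.Bijective fun f : V ⟶ Y ⊗ U => f ⊵ₗ X := by
  let e : ((Y' ⊗ V) ⊙ₗ X ⟶ U ⊙ₗ X) ≃ (V ⊙ₗ X ⟶ (Y ⊗ U) ⊙ₗ X) :=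
    ((αₗ Y' V X).homFromEquiv.trans (actLeftHomEquiv Y Y' (V ⊙ₗ X) (U ⊙ₗ X))).trans
      (αₗ Y U X).symm.homToEquiv
  have he : (fun f : V ⟶ Y ⊗ U => f ⊵ₗ X) =
      e ∘ (fun f : Y' ⊗ V ⟶ U => f ⊵ₗ X) ∘ (tensorLeftHomEquiv V Y Y' U).symm := by
    funext f
    simp [e, actLeftHomEquiv_actionHomLeft]
  rw [he]
  exact e.bijective.comp (h.comp (Equiv.bijective _))

theorem actionHomLeft_bijective_of_unit [RightRigidCategory C] (X : M)
    (h : ∀ V : C, Function.Bijective fun f : V ⟶ 𝟙_ C => f ⊵ₗ X) (V W : C) :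
    Function.Bijective fun f : V ⟶ W => f ⊵ₗ X := by
  have hW := actionHomLeft_bijective_of_exactPairing X W Wᘁ (h (Wᘁ ⊗ V))
  have he : (fun f : V ⟶ W => f ⊵ₗ X) = (asIso ((ρ_ W).hom ⊵ₗ X)).homToEquiv ∘
      (fun f : V ⟶ W ⊗ 𝟙_ C => f ⊵ₗ X) ∘ (ρ_ W).homToEquiv.symm := by
    funext f
    simp [-rightUnitor_actionHom]
  rw [he]
  exact (Equiv.bijective _).comp (hW.comp (Equiv.bijective _))

section Bilinear

variable [Preadditive C] [Linear ℂ C] [Preadditive M] [Linear ℂ M] [IsBilinearAction C M]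

instance (c : C) : (actLeft M c).Additive where
  map_add := IsBilinearAction.actionHomRight_add c _ _

instance (c : C) : (actLeft M c).Linear ℂ where
  map_smul f r := IsBilinearAction.actionHomRight_smul c r f

instance (X : M) : (actRight C X).Additive where
  map_add := IsBilinearAction.add_actionHomLeft _ _ X

instance (X : M) : (actRight C X).Linear ℂ where
  map_smul f r := IsBilinearAction.smul_actionHomLeft r f X

end Bilinear

end Action

/-! ### Semisimple tensor categories -/

section Semisimple

variable (C : Type*) [Category* C] [Preadditive C] [HasFiniteBiproducts C]

/-- Schur's lemma for all indecomposable objects. For a Krull–Schmidt category this is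
semisimplicity. -/
class IsSemisimpleCategory : Prop where
  isIso_of_ne_zero {X Y : C} (hX : Indecomposable X) (hY : Indecomposable Y) (f : X ⟶ Y)
    (hf : f ≠ 0) : IsIso f

variable {C} [IsSemisimpleCategory C] [Fact (IsKrullSchmidt C)]

theorem nonempty_retract_of_ne_zero {V X : C} (hX : Indecomposable X) {f : V ⟶ X}
    (hf : f ≠ 0) : Nonempty (Retract X V) := by
  induction V using krullSchmidt_induction with
  | iso V W e ih =>
    obtain ⟨r⟩ := ih (f := e.hom ≫ f) (by rwa [Ne, ← comp_zero (f := e.hom), cancel_epi])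
    exact ⟨r.trans (Retract.ofIso e)⟩
  | zero V hV => exact (hf (hV.eq_of_src f 0)).elim
  | add i V ih =>
    by_cases hi : biprod.inl ≫ f = 0
    · have hV : biprod.inr ≫ f ≠ 0 := fun hV =>
        hf (biprod.hom_ext' _ _ (by rw [hi, comp_zero]) (by rw [hV, comp_zero]))
      obtain ⟨r⟩ := ih hV
      exact ⟨r.trans ⟨biprod.inr, biprod.snd, biprod.inr_snd⟩⟩
    · have := IsSemisimpleCategory.isIso_of_ne_zero i.indecomposable_rep hX _ hi
      exact ⟨(Retract.ofIso (asIso (biprod.inl ≫ f)).symm).trans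
        ⟨biprod.inl, biprod.fst, biprod.inl_fst⟩⟩

end Semisimple

section Rigid

open MonoidalLeftAction

variable {C : Type*} [Category* C] [MonoidalCategory C] [Preadditive C] [Linear ℂ C]
  [IsBilinearAction C C]

theorem evaluation_ne_zero {Y Y' : C} [ExactPairing Y Y'] (hY : ¬ IsZero Y) : ε_ Y Y' ≠ 0 := by
  intro h
  have hzigzag := ExactPairing.evaluation_coevaluation Y Y'
  rw [h, show Y ◁ (0 : Y' ⊗ Y ⟶ 𝟙_ C) = 0 from (actLeft C Y).map_zero _ _, comp_zero,
    comp_zero] at hzigzag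
  have hiso : IsIso (0 : 𝟙_ C ⊗ Y ⟶ Y ⊗ 𝟙_ C) := hzigzag ▸ inferInstance
  exact hY (((IsZero.iff_id_eq_zero _).2 (isIsoZeroEquiv _ _ hiso).1).of_iso (λ_ Y).symm)

variable [HasFiniteBiproducts C] [IsSemisimpleCategory C] [Fact (IsKrullSchmidt C)]
  [RightRigidCategory C] (hunit : Indecomposable (𝟙_ C))
  {M : Type*} [Category* M] [Preadditive M] [Linear ℂ M]
  [MonoidalLeftAction C M] [IsBilinearAction C M]

include hunit in
theorem not_isZero_actionObj {Y : C} {X : M} (hY : ¬ IsZero Y) (hX : ¬ IsZero X) :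
    ¬ IsZero (Y ⊙ₗ X) := by
  intro h
  obtain ⟨r⟩ := nonempty_retract_of_ne_zero hunit (evaluation_ne_zero (Y' := Yᘁ) hY)
  have hYX : IsZero ((Yᘁ ⊗ Y) ⊙ₗ X) := ((actLeft M Yᘁ).map_isZero h).of_iso (αₗ Yᘁ Y X)
  have hunitX : IsZero (𝟙_ C ⊙ₗ X) := by
    rw [IsZero.iff_id_eq_zero, ← id_actionHomLeft, ← r.retract, comp_actionHomLeft,
      hYX.eq_of_tgt (r.i ⊵ₗ X) 0, zero_comp]
  exact hX (hunitX.of_iso (λₗ[C] X).symm)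

end Rigid

/-! ### Multiplicities in a module category with the regular graph -/

section FinsuppNat

variable {α β : Type*}

theorem exists_eq_single_of_degree_eq_one {f : α →₀ ℕ} (h : f.degree = 1) :
    ∃ a, f = Finsupp.single a 1 := by
  have hf : f ≠ 0 := fun h0 => by simp [h0] at h
  obtain ⟨a, ha⟩ := Finsupp.ne_iff.1 hf
  rw [Finsupp.zero_apply] at ha
  have hdeg := congrArg Finsupp.degree (Finsupp.single_add_erase a f)
  rw [map_add, Finsupp.degree_single, h] at hdeg
  have herase : f.erase a = 0 := (Finsupp.degree_eq_zero_iff _).1 (by omega)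
  rw [herase, map_zero] at hdeg
  exact ⟨a, by rw [← Finsupp.single_add_erase a f, herase, add_zero, show f a = 1 by omega]⟩

variable {f : α →₀ ℕ} {π σ : α → β}

theorem image_support_eq_of_mapDomain_eq [DecidableEq β] (h : f.mapDomain π = f.mapDomain σ) :
    f.support.image π = f.support.image σ := by
  rw [← Finsupp.mapDomain_support_of_subsingletonAddUnits, h,
    Finsupp.mapDomain_support_of_subsingletonAddUnits]

theorem injOn_support_of_mapDomain_eq (hσ : Function.Injective σ)
    (h : f.mapDomain π = f.mapDomain σ) : Set.InjOn π f.support := by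
  classical
  rw [← Finset.card_image_iff, image_support_eq_of_mapDomain_eq h,
    Finset.card_image_of_injective _ hσ]

end FinsuppNat

section TensorPow

variable {C : Type*} [Category* C] [MonoidalCategory C]

/-- The tensor power `F ⊗ (F ⊗ ⋯ (F ⊗ 𝟙))`. -/
def tensorPow (F : C) : ℕ → C
  | 0 => 𝟙_ C
  | n + 1 => F ⊗ tensorPow F n

/-- Every indecomposable object is a direct summand of a tensor power of `F`. -/
def IsTensorGenerator [Preadditive C] [HasFiniteBiproducts C] (F : C) : Prop :=
  ∀ X : C, Indecomposable X → ∃ n, Nonempty (Retract X (tensorPow F n))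

end TensorPow

section RegularGraph

open MonoidalLeftAction

variable {C : Type*} [Category* C] [MonoidalCategory C] [Preadditive C] [Linear ℂ C]
  [HasFiniteBiproducts C] [Fact (IsKrullSchmidt C)]
  [∀ X Y : C, Module.Finite ℂ (X ⟶ Y)]
  {M : Type*} [Category* M] [Preadditive M] [Linear ℂ M] [HasFiniteBiproducts M]
  [MonoidalLeftAction C M] [Fact (IsKrullSchmidt M)] [∀ X Y : M, Module.Finite ℂ (X ⟶ Y)]

/-- The map `σ` on indecomposable objects is compatible with the decompositions of the objects
`F ⊗ a` and `F (σ a)`. -/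
def PreservesMult (F : C) (σ : IndecClass C → IndecClass M) : Prop :=
  ∀ a : IndecClass C, indecMult (F ⊙ₗ (σ a).rep) = (indecMult (F ⊗ a.rep)).mapDomain σ

theorem preservesMult_of_edges_eq (F : C) (σ : IndecClass C ≃ IndecClass M)
    (hσ : ∀ a b, (actionGraph M F).edges (σ a) (σ b) = (actionGraph C F).edges a b) :
    PreservesMult F σ := fun a => by
  ext j
  obtain ⟨b, rfl⟩ := σ.surjective j
  rw [Finsupp.mapDomain_apply σ.injective, ← summandMultiplicity_rep, ← summandMultiplicity_rep]
  exact hσ a b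

variable [IsBilinearAction C C] [IsBilinearAction C M]
variable {F : C} {σ : IndecClass C → IndecClass M} {X : M}

theorem PreservesMult.tensorPow_actionObj (hF : PreservesMult F σ)
    (hX : indecMult X = (indecMult (𝟙_ C)).mapDomain σ) (n : ℕ) :
    indecMult (tensorPow F n ⊙ₗ X) = (indecMult (tensorPow F n)).mapDomain σ := by
  induction n with
  | zero => exact (indecMult_congr (λₗ[C] X)).trans hX
  | succ n ih =>
    have hM := indecMult_functor (actLeft M F) (tensorPow F n ⊙ₗ X)
    have hC := indecMult_functor (actLeft C F) (tensorPow F n)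
    refine (indecMult_congr (αₗ F (tensorPow F n) X)).trans (hM.trans ?_)
    refine Eq.trans ?_ (congrArg (Finsupp.mapDomain σ) hC.symm)
    rw [ih, Finsupp.sum_mapDomain_index (by simp) (fun _ _ _ => add_smul _ _ _), Finsupp.sum,
      Finsupp.sum, Finsupp.mapDomain_finsetSum]
    refine Finset.sum_congr rfl fun a _ => ?_
    rw [Finsupp.mapDomain_smul]
    exact congrArg _ (hF a)

variable [IsSemisimpleCategory C] [RightRigidCategory C]

theorem PreservesMult.exists_indecMult_actionObj_eq_single (hF : PreservesMult F σ)
    (hunit : Indecomposable (𝟙_ C)) (hgen : IsTensorGenerator F) (hX0 : ¬ IsZero X)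
    (hX : indecMult X = (indecMult (𝟙_ C)).mapDomain σ) (i : IndecClass C) :
    ∃ j, indecMult (i.rep ⊙ₗ X) = Finsupp.single j 1 := by
  obtain ⟨n, r⟩ := hgen i.rep i.indecomposable_rep
  rw [← indecMult_ne_zero_iff_nonempty_retract] at r
  have hpos (k : IndecClass C) : 1 ≤ (indecMult (k.rep ⊙ₗ X)).degree := by
    rw [Nat.one_le_iff_ne_zero, Ne, Finsupp.degree_eq_zero_iff]
    exact fun h => not_isZero_actionObj hunit k.indecomposable_rep.1 hX0
      (isZero_of_indecMult_eq_zero h)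
  -- Both sides count the indecomposable summands, of `tensorPow F n` and of its action on `X`.
  have hdeg : ∑ k ∈ (indecMult (tensorPow F n)).support, indecMult (tensorPow F n) k =
      ∑ k ∈ (indecMult (tensorPow F n)).support,
        indecMult (tensorPow F n) k * (indecMult (k.rep ⊙ₗ X)).degree := by
    have h := congrArg Finsupp.degree ((hF.tensorPow_actionObj hX n).symm.trans
      (indecMult_functor (actRight C X) (tensorPow F n)))
    rw [Finsupp.degree_mapDomain, Finsupp.sum, map_sum, Finsupp.degree_apply] at h
    simp only [map_nsmul, smul_eq_mul] at h
    exact h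
  have hi := (Finset.sum_eq_sum_iff_of_le fun k _ =>
    Nat.le_mul_of_pos_right (indecMult (tensorPow F n) k) (hpos k)).1 hdeg i
      (Finsupp.mem_support_iff.2 r)
  exact exists_eq_single_of_degree_eq_one
    (Nat.eq_of_mul_eq_mul_left (Nat.pos_of_ne_zero r) (by rw [mul_one]; exact hi.symm))

theorem PreservesMult.exists_bijective (hF : PreservesMult F σ) (hσ : Function.Bijective σ)
    (hunit : Indecomposable (𝟙_ C)) (hgen : IsTensorGenerator F) (hX0 : ¬ IsZero X)
    (hX : indecMult X = (indecMult (𝟙_ C)).mapDomain σ) :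
    ∃ π : IndecClass C → IndecClass M, Function.Bijective π ∧
      ∀ i, indecMult (i.rep ⊙ₗ X) = Finsupp.single (π i) 1 := by
  classical
  choose π hπ using hF.exists_indecMult_actionObj_eq_single hunit hgen hX0 hX
  have hπσ (n : ℕ) : (indecMult (tensorPow F n)).mapDomain π =
      (indecMult (tensorPow F n)).mapDomain σ := by
    rw [← hF.tensorPow_actionObj hX n]
    exact (indecMult_functor_of_single (actRight C X) hπ _).symm
  have hmem (i : IndecClass C) : ∃ n, indecMult (tensorPow F n) i ≠ 0 := by
    simpa only [indecMult_ne_zero_iff_nonempty_retract] using hgen i.rep i.indecomposable_rep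
  refine ⟨π, ⟨fun i j hij => ?_, fun j => ?_⟩, hπ⟩
  · obtain ⟨m, hm⟩ := hmem i
    obtain ⟨n, hn⟩ := hmem j
    have hinj : Set.InjOn π (indecMult (tensorPow F m) + indecMult (tensorPow F n)).support :=
      injOn_support_of_mapDomain_eq hσ.1 (by
        rw [Finsupp.mapDomain_add, Finsupp.mapDomain_add, hπσ, hπσ])
    exact hinj (by simp [hm]) (by simp [hn]) hij
  · obtain ⟨a, rfl⟩ := hσ.2 j
    obtain ⟨n, hn⟩ := hmem a
    have ha : σ a ∈ (indecMult (tensorPow F n)).support.image π := by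
      rw [image_support_eq_of_mapDomain_eq (hπσ n)]
      exact Finset.mem_image_of_mem _ (Finsupp.mem_support_iff.2 hn)
    obtain ⟨i, -, hi⟩ := Finset.mem_image.1 ha
    exact ⟨i, hi⟩

end RegularGraph

/-! ### Stable ideals generated by a morphism -/

section GeneratedIdeal

open MonoidalLeftAction

variable {C : Type*} [Category* C] [MonoidalCategory C]
variable {M : Type*} [Category* M] [Preadditive M] [Linear ℂ M] [MonoidalLeftAction C M]

variable (C) in
/-- The `C`-stable ideal generated by a morphism. -/
def CatIdeal.generated {X Y : M} (r : X ⟶ Y) : CatIdeal M where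
  homs A B := Submodule.span ℂ {f | ∃ (c : C) (a : A ⟶ c ⊙ₗ X) (b : c ⊙ₗ Y ⟶ B),
    f = a ≫ c ⊴ₗ r ≫ b}
  precomp_mem {A B D} g {f} hf := by
    refine Submodule.span_le (p := (Submodule.span ℂ _).comap (Linear.leftComp ℂ D g)).2 ?_ hf
    rintro _ ⟨c, a, b, rfl⟩
    exact Submodule.subset_span ⟨c, g ≫ a, b, by simp⟩
  postcomp_mem {A B D} f hf g := by
    refine Submodule.span_le (p := (Submodule.span ℂ _).comap (Linear.rightComp ℂ A g)).2 ?_ hf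
    rintro _ ⟨c, a, b, rfl⟩
    exact Submodule.subset_span ⟨c, a, b ≫ g, by simp⟩

theorem CatIdeal.mem_generated {X Y : M} (r : X ⟶ Y) :
    r ∈ (CatIdeal.generated C r).homs X Y :=
  Submodule.subset_span ⟨𝟙_ C, (λₗ[C] X).inv, (λₗ[C] Y).hom, by simp⟩

variable [Preadditive C] [Linear ℂ C] [IsBilinearAction C M]

theorem CatIdeal.isStable_generated {X Y : M} (r : X ⟶ Y) :
    (CatIdeal.generated C r).IsStable C := by
  intro d A B f hf
  refine Submodule.span_le
    (p := (Submodule.span ℂ _).comap ((actLeft M d).mapLinearMap ℂ (X := A) (Y := B))).2 ?_ hf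
  rintro _ ⟨c, a, b, rfl⟩
  refine Submodule.subset_span
    ⟨d ⊗ c, d ⊴ₗ a ≫ (αₗ d c X).inv, (αₗ d c Y).hom ≫ d ⊴ₗ b, ?_⟩
  change d ⊴ₗ (a ≫ c ⊴ₗ r ≫ b) = _
  simp

theorem exists_isIso_comp_actionHomRight_comp (hM : IsSimpleModuleCategory C M) {X Y : M}
    {r : X ⟶ Y} (hr : r ≠ 0) (Z : M) [IsLocalRing (End Z)] :
    ∃ (c : C) (a : Z ⟶ c ⊙ₗ X) (b : c ⊙ₗ Y ⟶ Z), IsIso (a ≫ c ⊴ₗ r ≫ b) := by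
  rcases hM.eq_bot_or_eq_top _ (CatIdeal.isStable_generated (C := C) r) with h | h
  · have hmem := CatIdeal.mem_generated (C := C) r
    rw [h, Submodule.mem_bot] at hmem
    exact (hr hmem).elim
  · by_contra! hn
    have hle : (CatIdeal.generated C r).homs Z Z ≤ radHom Z Z := by
      refine Submodule.span_le.2 ?_
      rintro _ ⟨c, a, b, rfl⟩ g
      rw [Category.assoc, Category.assoc]
      exact hn c a (b ≫ g)
    have hid : 𝟙 Z ∈ radHom Z Z := hle (h Z Z ▸ Submodule.mem_top)
    exact hid (𝟙 Z) inferInstance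

variable [HasFiniteBiproducts C]

theorem biprod_actionHomRight (A B : C) {X Y : M} (r : X ⟶ Y) :
    (A ⊞ B) ⊴ₗ r = (biprod.fst : A ⊞ B ⟶ A) ⊵ₗ X ≫ A ⊴ₗ r ≫ biprod.inl ⊵ₗ Y +
      (biprod.snd : A ⊞ B ⟶ B) ⊵ₗ X ≫ B ⊴ₗ r ≫ biprod.inr ⊵ₗ Y := by
  rw [action_exchange, action_exchange, ← Category.assoc, ← Category.assoc,
    ← Preadditive.add_comp]
  have htotal := map_fst_inl_add_map_snd_inr (actRight C X) A B
  exact ((congrArg (· ≫ (A ⊞ B) ⊴ₗ r) htotal).trans (Category.id_comp _)).symm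

theorem exists_isIso_comp_rep_actionHomRight_comp [Fact (IsKrullSchmidt C)]
    (hM : IsSimpleModuleCategory C M) {X Y : M} {r : X ⟶ Y} (hr : r ≠ 0) (Z : M)
    [IsLocalRing (End Z)] :
    ∃ (k : IndecClass C) (a : Z ⟶ k.rep ⊙ₗ X) (b : k.rep ⊙ₗ Y ⟶ Z),
      IsIso (a ≫ k.rep ⊴ₗ r ≫ b) := by
  obtain ⟨c, a, b, h⟩ := exists_isIso_comp_actionHomRight_comp hM hr Z
  induction c using krullSchmidt_induction with
  | iso V W e ih =>
    refine ih (a ≫ e.inv ⊵ₗ X) (e.hom ⊵ₗ Y ≫ b) ?_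
    rwa [Category.assoc, action_exchange_assoc, inv_hom_actionHomLeft_assoc]
  | zero V hV =>
    have ha : a = 0 := ((actRight C X).map_isZero hV).eq_of_tgt a 0
    rw [ha, zero_comp] at h
    exact (not_isIso_zero_end Z h).elim
  | add i V ih =>
    rw [biprod_actionHomRight, Preadditive.add_comp, Preadditive.comp_add,
      ← Category.comp_id (_ + _)] at h
    rcases isIso_or_isIso_of_isIso_add h with h | h
    · exact ⟨i, a ≫ biprod.fst ⊵ₗ X, biprod.inl ⊵ₗ Y ≫ b, by simpa using h⟩
    · exact ih (a ≫ biprod.snd ⊵ₗ X) (biprod.inr ⊵ₗ Y ≫ b) (by simpa using h)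

end GeneratedIdeal

/-! ### Module categories with the graph of the left regular one -/

section Recognition

open MonoidalLeftAction

variable {C : Type*} [Category* C] [MonoidalCategory C] [Preadditive C] [HasFiniteBiproducts C]
  {M : Type*} [Category* M] [Preadditive M] [Linear ℂ M] [HasFiniteBiproducts M]
  [MonoidalLeftAction C M] [Fact (IsKrullSchmidt M)] [∀ X Y : M, Module.Finite ℂ (X ⟶ Y)]

variable {X : M} {π : IndecClass C → IndecClass M}
  (hπ : ∀ i, indecMult (i.rep ⊙ₗ X) = Finsupp.single (π i) 1)

theorem isLocalRing_end_of_indecMult_eq_single {Y : M} {j : IndecClass M}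
    (h : indecMult Y = Finsupp.single j 1) : IsLocalRing (End Y) :=
  isLocalRing_end_of_iso (nonempty_iso_of_indecMult_eq_single h).some.symm

include hπ in
theorem indecMult_eq_single_of_unit_iso {o : IndecClass C} (u : 𝟙_ C ≅ o.rep) :
    indecMult X = Finsupp.single (π o) 1 := by
  rw [← hπ o, indecMult_congr (λₗ[C] X).symm]
  exact indecMult_congr ((actRight C X).mapIso u)

variable [Linear ℂ C] [Fact (IsKrullSchmidt C)] [IsBilinearAction C M]

include hπ in
theorem isIso_of_rep_actionObj_hom_ne_zero (hM : IsSimpleModuleCategory C M)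
    (hunit : Indecomposable (𝟙_ C)) (hinj : Function.Injective π) {k : IndecClass C}
    {r : k.rep ⊙ₗ X ⟶ X} (hr : r ≠ 0) : IsIso r := by
  obtain ⟨o, ⟨u⟩⟩ := IndecClass.exists_iso hunit
  have hX := indecMult_eq_single_of_unit_iso hπ u
  have := isLocalRing_end_of_indecMult_eq_single hX
  have := fun i => isLocalRing_end_of_indecMult_eq_single (hπ i)
  obtain ⟨l, a, b, h⟩ := exists_isIso_comp_rep_actionHomRight_comp hM hr X
  have har : IsIso (a ≫ l.rep ⊴ₗ r) := isIso_of_isIso_comp _ b (by rwa [Category.assoc])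
  obtain rfl : l = o := by
    have h := indecMult_congr (asIso (a ≫ l.rep ⊴ₗ r))
    rw [hπ, hX] at h
    exact hinj ((Finsupp.single_left_inj one_ne_zero).1 h).symm
  have : IsLocalRing (End (l.rep ⊙ₗ k.rep ⊙ₗ X)) := isLocalRing_end_of_iso
    ((λₗ[C] (k.rep ⊙ₗ X)).symm ≪≫ (actRight C (k.rep ⊙ₗ X)).mapIso u)
  have ha : IsIso a := isIso_of_isIso_comp _ _ h
  have hlr : IsIso (l.rep ⊴ₗ r) := IsIso.of_isIso_comp_left a _
  have hconj : r = (λₗ[C] (k.rep ⊙ₗ X)).inv ≫ u.hom ⊵ₗ (k.rep ⊙ₗ X) ≫ l.rep ⊴ₗ r ≫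
      u.inv ⊵ₗ X ≫ (λₗ[C] X).hom := by
    rw [action_exchange_assoc, hom_inv_actionHomLeft_assoc]
    simp
  rw [hconj]
  infer_instance

variable [IsSemisimpleCategory C]

include hπ in
theorem actRight_map_bijective_of_rep_of_unit (hM : IsSimpleModuleCategory C M)
    (hunit : Indecomposable (𝟙_ C)) (hinj : Function.Injective π) (k : IndecClass C) :
    Function.Bijective
      ((actRight C X).map : (k.rep ⟶ 𝟙_ C) → (k.rep ⊙ₗ X ⟶ 𝟙_ C ⊙ₗ X)) := by
  obtain ⟨o, ⟨u⟩⟩ := IndecClass.exists_iso hunit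
  have := isLocalRing_end_of_indecMult_eq_single (hπ k)
  have hiso_of_ne {r : k.rep ⊙ₗ X ⟶ 𝟙_ C ⊙ₗ X} (hr : r ≠ 0) : IsIso r := by
    have := isIso_of_rep_actionObj_hom_ne_zero hπ hM hunit hinj (r := r ≫ (λₗ[C] X).hom)
      (fun h => hr (by rwa [← cancel_mono (λₗ[C] X).hom, zero_comp]))
    exact IsIso.of_isIso_comp_right r (λₗ[C] X).hom
  refine ⟨(injective_iff_map_eq_zero (actRight C X).mapAddHom).2 fun f hf => ?_,
    fun (r : k.rep ⊙ₗ X ⟶ 𝟙_ C ⊙ₗ X) => ?_⟩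
  · by_contra hf0
    have := IsSemisimpleCategory.isIso_of_ne_zero k.indecomposable_rep hunit f hf0
    have hiso : IsIso (0 : k.rep ⊙ₗ X ⟶ 𝟙_ C ⊙ₗ X) :=
      (show f ⊵ₗ X = 0 from hf) ▸ (inferInstance : IsIso (f ⊵ₗ X))
    exact (indecomposable_of_isLocalRing_end (k.rep ⊙ₗ X)).1
      ((IsZero.iff_id_eq_zero _).2 (isIsoZeroEquiv _ _ hiso).1)
  · by_cases hr : r = 0
    · exact ⟨0, ((actRight C X).map_zero _ _).trans hr.symm⟩
    have := hiso_of_ne hr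
    have hk : k = o := hinj ((Finsupp.single_left_inj one_ne_zero).1 (by
      rw [← hπ k, ← indecMult_eq_single_of_unit_iso hπ u,
        indecMult_congr (asIso r ≪≫ λₗ[C] X)]))
    subst hk
    obtain ⟨c, hc⟩ := exists_not_isIso_sub_smul (k.rep ⊙ₗ X) (r ≫ u.hom ⊵ₗ X)
    refine ⟨c • u.inv, ?_⟩
    by_contra hne'
    have hsub : IsIso (r - (c • u.inv) ⊵ₗ X) := hiso_of_ne (sub_ne_zero.2 (Ne.symm hne'))
    have hcomp : r ≫ u.hom ⊵ₗ X - c • 𝟙 (k.rep ⊙ₗ X) =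
        (r - (c • u.inv) ⊵ₗ X) ≫ u.hom ⊵ₗ X := by
      rw [IsBilinearAction.smul_actionHomLeft, Preadditive.sub_comp, Linear.smul_comp,
        inv_hom_actionHomLeft]
    exact hc (hcomp ▸ inferInstance)

include hπ in
theorem isEquivalence_actRight [RightRigidCategory C] (hM : IsSimpleModuleCategory C M)
    (hunit : Indecomposable (𝟙_ C)) (hbij : Function.Bijective π) :
    (actRight C X).IsEquivalence := by
  have hff (V W : C) := actionHomLeft_bijective_of_unit X
    (map_bijective_of_rep (actRight C X)
      (actRight_map_bijective_of_rep_of_unit hπ hM hunit hbij.1)) V W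
  exact
    { faithful := ⟨fun {V W} _ _ hfg => (hff V W).1 hfg⟩
      full := ⟨fun {V W} r => (hff V W).2 r⟩
      essSurj := essSurj_of_rep _ fun j => by
        obtain ⟨i, rfl⟩ := hbij.2 j
        exact ⟨i.rep, nonempty_iso_of_indecMult_eq_single (hπ i)⟩ }

theorem moduleCategoriesEquivalent_of_actionGraph_isomorphic [∀ X Y : C, Module.Finite ℂ (X ⟶ Y)]
    [IsBilinearAction C C] [RightRigidCategory C]
    (hunit : Indecomposable (𝟙_ C)) {F : C} (hgen : IsTensorGenerator F)
    (hM : IsSimpleModuleCategory C M)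
    (hgraph : (actionGraph C F).Isomorphic (actionGraph M F)) :
    ModuleCategoriesEquivalent C C M := by
  obtain ⟨σ, hσ⟩ := hgraph
  obtain ⟨o, ⟨u⟩⟩ := IndecClass.exists_iso hunit
  have hX : indecMult (σ o).rep = (indecMult (𝟙_ C)).mapDomain σ := by
    rw [indecMult_congr u, indecMult_rep, indecMult_rep, Finsupp.mapDomain_single]
  obtain ⟨π, hbij, hπ⟩ := (preservesMult_of_edges_eq F σ hσ).exists_bijective σ.bijective hunit
    hgen (σ o).indecomposable_rep.1 hX
  exact ⟨actRight C (σ o).rep, isEquivalence_actRight hπ hM hunit hbij, inferInstance,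
    inferInstance, ⟨inferInstance⟩⟩

end Recognition

section SpecialLinear

variable {K n : Type*} [Field K] [CharZero K] [Fintype n] [DecidableEq n]

open LieAlgebra.SpecialLinear (sl)

/-- The orthogonal projection `E i j - δ i j / n • 1` of the matrix unit `E i j` to `sl n`. -/
def tracelessUnit (i j : n) : sl n K :=
  ⟨Matrix.single i j 1 - (if i = j then (Fintype.card n : K)⁻¹ else 0) • 1, by
    have : Nonempty n := ⟨i⟩
    change Matrix.trace _ = 0
    rw [Matrix.trace_sub, Matrix.trace_smul, Matrix.trace_one]
    by_cases h : i = j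
    · subst h; simp
    · simp [h]⟩

theorem tracelessUnit_val (i j : n) :
    (tracelessUnit i j : sl n K).1 =
      Matrix.single i j 1 - (if i = j then (Fintype.card n : K)⁻¹ else 0) • 1 := rfl

theorem tracelessUnit_ne_zero {i j : n} (hij : i ≠ j) : (tracelessUnit i j : sl n K) ≠ 0 := by
  intro h
  have := congrFun (congrFun (congrArg Subtype.val h) i) j
  rw [tracelessUnit_val, if_neg hij] at this
  simp at this

theorem lie_tracelessUnit (i j k l : n) :
    ⁅(tracelessUnit i j : sl n K), tracelessUnit k l⁆ =
      (if j = k then (tracelessUnit i l : sl n K) else 0) -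
        (if l = i then (tracelessUnit k j : sl n K) else 0) := by
  have single_mul_single (a b c d : n) :
      Matrix.single a b (1 : K) * Matrix.single c d 1 =
        if b = c then Matrix.single a d 1 else 0 := by
    split_ifs with h
    · subst h; simp
    · simp [h]
  apply Subtype.ext
  rw [LieAlgebra.SpecialLinear.sl_bracket, AddSubgroupClass.coe_sub]
  simp only [apply_ite Subtype.val, ZeroMemClass.coe_zero, tracelessUnit_val, sub_mul, mul_sub,
    smul_mul_assoc, mul_smul_comm, one_mul, mul_one, single_mul_single]
  by_cases hjk : j = k <;> by_cases hli : l = i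
  · subst hjk hli; simp only [if_true, eq_comm (a := j) (b := l)]; module
  · subst hjk; simp only [if_true, hli, if_false, eq_comm (a := i) (b := l)]; module
  · subst hli; simp only [if_true, hjk, if_false, eq_comm (a := k) (b := j)]; module
  · simp only [hjk, hli, if_false]; module

theorem eq_sum_tracelessUnit (x : sl n K) : x = ∑ i, ∑ j, x.1 i j • tracelessUnit i j := by
  have trace_eq_zero : ∑ i, x.1 i i = 0 := x.2
  apply Subtype.ext
  simp only [AddSubmonoidClass.coe_finsetSum, SetLike.val_smul, tracelessUnit_val, smul_sub,
    Finset.sum_sub_distrib, Matrix.smul_single, smul_eq_mul, mul_one, ite_smul, zero_smul,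
    smul_ite, smul_zero, Finset.sum_ite_eq, Finset.mem_univ, if_true]
  rw [← Matrix.matrix_eq_sum_single x.1, ← Finset.sum_smul, trace_eq_zero, zero_smul, sub_zero]

theorem sum_tracelessUnit_self : ∑ i : n, (tracelessUnit i i : sl n K) = 0 := by
  apply Subtype.ext
  simp only [AddSubmonoidClass.coe_finsetSum, tracelessUnit_val, if_true,
    Finset.sum_sub_distrib, Finset.sum_const, Finset.card_univ, ZeroMemClass.coe_zero]
  rcases isEmpty_or_nonempty n with _ | _
  · simp
  · rw [← Nat.cast_smul_eq_nsmul K, smul_smul, mul_inv_cancel₀ (by simp), one_smul, sub_eq_zero]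
    ext i j
    simp [Matrix.sum_apply, Matrix.single_apply, Matrix.one_apply, ite_and]

section Casimir

variable (V : Type*) [AddCommGroup V] [Module K V] [LieRingModule (sl n K) V]
  [LieModule K (sl n K) V]

variable (K n) in
/-- The action on `V` of the quadratic Casimir element of `sl n` for the trace form. -/
def casimir : Module.End K V :=
  ∑ i, ∑ j, LieModule.toEnd K (sl n K) V (tracelessUnit i j) *
    LieModule.toEnd K (sl n K) V (tracelessUnit j i)

variable {V}

theorem casimir_apply (v : V) :
    casimir K n V v =
      ∑ i, ∑ j, ⁅(tracelessUnit i j : sl n K), ⁅(tracelessUnit j i : sl n K), v⁆⁆ := by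
  simp [casimir]

theorem casimir_lie_tracelessUnit (k l : n) (v : V) :
    casimir K n V ⁅(tracelessUnit k l : sl n K), v⁆ =
      ⁅(tracelessUnit k l : sl n K), casimir K n V v⁆ := by
  let E (i j : n) : sl n K := tracelessUnit i j
  have commute_past (i j : n) : ⁅E k l, ⁅E i j, ⁅E j i, v⁆⁆⁆ =
      (if l = i then ⁅E k j, ⁅E j i, v⁆⁆ else 0) - (if j = k then ⁅E i l, ⁅E j i, v⁆⁆ else 0) +
      ((if l = j then ⁅E i j, ⁅E k i, v⁆⁆ else 0) - (if i = k then ⁅E i j, ⁅E j l, v⁆⁆ else 0)) +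
      ⁅E i j, ⁅E j i, ⁅E k l, v⁆⁆⁆ := by
    rw [leibniz_lie, leibniz_lie (E k l) (E j i), lie_tracelessUnit, lie_tracelessUnit, lie_add,
      sub_lie, sub_lie, lie_sub]
    split_ifs <;> (try simp only [zero_lie, lie_zero]) <;> abel
  change casimir K n V ⁅E k l, v⁆ = ⁅E k l, casimir K n V v⁆
  simp only [casimir_apply, lie_sum]
  change ∑ i, ∑ j, ⁅E i j, ⁅E j i, ⁅E k l, v⁆⁆⁆ = ∑ i, ∑ j, ⁅E k l, ⁅E i j, ⁅E j i, v⁆⁆⁆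
  simp only [commute_past, Finset.sum_add_distrib, Finset.sum_sub_distrib, Finset.sum_ite_eq,
    Finset.sum_ite_eq', Finset.mem_univ, if_true]
  rw [Finset.sum_comm (f := fun i j => if l = i then ⁅E k j, ⁅E j i, v⁆⁆ else 0),
    Finset.sum_comm (f := fun i j => if i = k then ⁅E i j, ⁅E j l, v⁆⁆ else 0)]
  simp only [Finset.sum_ite_eq, Finset.sum_ite_eq', Finset.mem_univ, if_true]
  abel

theorem casimir_lie (x : sl n K) (v : V) : casimir K n V ⁅x, v⁆ = ⁅x, casimir K n V v⁆ := by
  rw [eq_sum_tracelessUnit x]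
  simp only [sum_lie, smul_lie, map_sum, map_smul, casimir_lie_tracelessUnit]

theorem map_casimir {W : Type*} [AddCommGroup W] [Module K W] [LieRingModule (sl n K) W]
    [LieModule K (sl n K) W] (φ : V →ₗ⁅K,sl n K⁆ W) (v : V) :
    φ (casimir K n V v) = casimir K n W (φ v) := by
  simp only [casimir_apply, map_sum, LieModuleHom.map_lie]

end Casimir

end SpecialLinear

local notation "e₁" => (tracelessUnit 0 1 : Sl3)
local notation "e₂" => (tracelessUnit 1 2 : Sl3)
local notation "f₁" => (tracelessUnit 1 0 : Sl3)
local notation "f₂" => (tracelessUnit 2 1 : Sl3)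
local notation "h₁" => (tracelessUnit 0 0 - tracelessUnit 1 1 : Sl3)
local notation "h₂" => (tracelessUnit 1 1 - tracelessUnit 2 2 : Sl3)

theorem lie_e₁_f₁ : ⁅e₁, f₁⁆ = h₁ := by simp [lie_tracelessUnit]

theorem lie_e₂_f₂ : ⁅e₂, f₂⁆ = h₂ := by simp [lie_tracelessUnit]

theorem lie_e₁_f₂ : ⁅e₁, f₂⁆ = 0 := by simp [lie_tracelessUnit]

theorem lie_e₂_f₁ : ⁅e₂, f₁⁆ = 0 := by simp [lie_tracelessUnit]

theorem lie_h₁_e₁ : ⁅h₁, e₁⁆ = (2 : ℂ) • e₁ := by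
  simp [sub_lie, lie_tracelessUnit, two_smul]

theorem lie_h₁_e₂ : ⁅h₁, e₂⁆ = (-1 : ℂ) • e₂ := by
  simp [sub_lie, lie_tracelessUnit]

theorem lie_h₂_e₁ : ⁅h₂, e₁⁆ = (-1 : ℂ) • e₁ := by
  simp [sub_lie, lie_tracelessUnit]

theorem lie_h₂_e₂ : ⁅h₂, e₂⁆ = (2 : ℂ) • e₂ := by
  simp [sub_lie, lie_tracelessUnit, two_smul]

theorem lie_h₁_f₁ : ⁅h₁, f₁⁆ = (-2 : ℂ) • f₁ := by
  simp only [sub_lie, lie_tracelessUnit]; simp; module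

theorem lie_h₁_f₂ : ⁅h₁, f₂⁆ = (1 : ℂ) • f₂ := by
  simp [sub_lie, lie_tracelessUnit]

theorem lie_h₂_f₁ : ⁅h₂, f₁⁆ = (1 : ℂ) • f₁ := by
  simp [sub_lie, lie_tracelessUnit]

theorem lie_h₂_f₂ : ⁅h₂, f₂⁆ = (-2 : ℂ) • f₂ := by
  simp only [sub_lie, lie_tracelessUnit]; simp; module

theorem lie_h₁_h₂ : ⁅h₁, h₂⁆ = 0 := by
  simp [sub_lie, lie_sub, lie_tracelessUnit]

theorem isSl2Triple_h₁ : IsSl2Triple h₁ e₁ f₁ where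
  h_ne_zero h := by
    have := lie_h₁_e₁
    rw [h, zero_lie] at this
    exact tracelessUnit_ne_zero (by decide) ((smul_eq_zero_iff_right two_ne_zero).1 this.symm)
  lie_e_f := lie_e₁_f₁
  lie_h_e_nsmul := by rw [lie_h₁_e₁]; module
  lie_h_f_nsmul := by rw [lie_h₁_f₁]; module

theorem isSl2Triple_h₂ : IsSl2Triple h₂ e₂ f₂ where
  h_ne_zero h := by
    have := lie_h₂_e₂
    rw [h, zero_lie] at this
    exact tracelessUnit_ne_zero (by decide) ((smul_eq_zero_iff_right two_ne_zero).1 this.symm)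
  lie_e_f := lie_e₂_f₂
  lie_h_e_nsmul := by rw [lie_h₂_e₂]; module
  lie_h_f_nsmul := by rw [lie_h₂_f₂]; module

theorem eq_top_of_chevalley_mem (S : LieSubalgebra ℂ Sl3) (he₁ : e₁ ∈ S) (he₂ : e₂ ∈ S)
    (hf₁ : f₁ ∈ S) (hf₂ : f₂ ∈ S) : S = ⊤ := by
  have hh₁ : h₁ ∈ S := lie_e₁_f₁ ▸ S.lie_mem he₁ hf₁
  have hh₂ : h₂ ∈ S := lie_e₂_f₂ ▸ S.lie_mem he₂ hf₂
  have mem_02 : tracelessUnit 0 2 ∈ S := by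
    simpa [lie_tracelessUnit] using S.lie_mem he₁ he₂
  have mem_20 : tracelessUnit 2 0 ∈ S := by
    simpa [lie_tracelessUnit] using S.lie_mem hf₂ hf₁
  have sum_diag := sum_tracelessUnit_self (K := ℂ) (n := Fin 3)
  rw [Fin.sum_univ_three] at sum_diag
  have mem_00 : tracelessUnit 0 0 ∈ S := by
    have : (tracelessUnit 0 0 : Sl3) = (2 / 3 : ℂ) • h₁ + (1 / 3 : ℂ) • h₂ := by
      linear_combination (norm := module) (1 / 3 : ℂ) • sum_diag
    exact this ▸ S.add_mem (S.smul_mem _ hh₁) (S.smul_mem _ hh₂)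
  have mem_11 : tracelessUnit 1 1 ∈ S := by simpa using S.sub_mem mem_00 hh₁
  have mem_22 : tracelessUnit 2 2 ∈ S := by simpa using S.sub_mem mem_11 hh₂
  refine eq_top_iff.2 fun x _ => eq_sum_tracelessUnit x ▸ ?_
  refine S.sum_mem fun i _ => S.sum_mem fun j _ => S.smul_mem _ ?_
  fin_cases i <;> fin_cases j <;> assumption

section Invariants

variable {V W : Type*} [AddCommGroup V] [Module ℂ V] [LieRingModule Sl3 V] [LieModule ℂ Sl3 V]
  [AddCommGroup W] [Module ℂ W] [LieRingModule Sl3 W] [LieModule ℂ Sl3 W]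

theorem lie_mem_of_chevalley_stable {N : Submodule ℂ V} (he₁ : ∀ v ∈ N, ⁅e₁, v⁆ ∈ N)
    (he₂ : ∀ v ∈ N, ⁅e₂, v⁆ ∈ N) (hf₁ : ∀ v ∈ N, ⁅f₁, v⁆ ∈ N) (hf₂ : ∀ v ∈ N, ⁅f₂, v⁆ ∈ N)
    (x : Sl3) {v : V} (hv : v ∈ N) : ⁅x, v⁆ ∈ N := by
  let stabilizer : LieSubalgebra ℂ Sl3 :=
    { carrier := {x | ∀ v ∈ N, ⁅x, v⁆ ∈ N}
      zero_mem' := fun v _ => by rw [zero_lie]; exact N.zero_mem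
      add_mem' := fun hx hy v hv => by rw [add_lie]; exact N.add_mem (hx v hv) (hy v hv)
      smul_mem' := fun c x hx v hv => by rw [smul_lie]; exact N.smul_mem c (hx v hv)
      lie_mem' := fun hx hy v hv => by
        rw [lie_lie]; exact N.sub_mem (hx _ (hy v hv)) (hy _ (hx v hv)) }
  have : x ∈ stabilizer := eq_top_of_chevalley_mem stabilizer he₁ he₂ hf₁ hf₂ ▸ trivial
  exact this v hv

theorem lie_eq_zero_of_chevalley {v : V} (he₁ : ⁅e₁, v⁆ = 0) (he₂ : ⁅e₂, v⁆ = 0)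
    (hf₁ : ⁅f₁, v⁆ = 0) (hf₂ : ⁅f₂, v⁆ = 0) (x : Sl3) : ⁅x, v⁆ = 0 := by
  let annihilator : LieSubalgebra ℂ Sl3 :=
    { carrier := {x | ⁅x, v⁆ = 0}
      zero_mem' := zero_lie v
      add_mem' := fun {x y} (hx : ⁅x, v⁆ = 0) (hy : ⁅y, v⁆ = 0) =>
        show ⁅x + y, v⁆ = 0 by rw [add_lie, hx, hy, add_zero]
      smul_mem' := fun c x (hx : ⁅x, v⁆ = 0) =>
        show ⁅c • x, v⁆ = 0 by rw [smul_lie, hx, smul_zero]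
      lie_mem' := fun {x y} (hx : ⁅x, v⁆ = 0) (hy : ⁅y, v⁆ = 0) =>
        show ⁅⁅x, y⁆, v⁆ = 0 by rw [lie_lie, hx, hy, lie_zero, lie_zero, sub_zero] }
  have : x ∈ annihilator := eq_top_of_chevalley_mem annihilator he₁ he₂ hf₁ hf₂ ▸ trivial
  exact this

theorem lie_eq_zero_of_forall_lie_lie {v : V} (hv : ∀ x y : Sl3, ⁅⁅x, y⁆, v⁆ = 0) (x : Sl3) :
    ⁅x, v⁆ = 0 := by
  have of_eigen {c : ℂ} (hc : c ≠ 0) {h y : Sl3} (hy : ⁅h, y⁆ = c • y) : ⁅y, v⁆ = 0 := by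
    have := hv h y
    rwa [hy, smul_lie, smul_eq_zero_iff_right hc] at this
  exact lie_eq_zero_of_chevalley (of_eigen two_ne_zero lie_h₁_e₁) (of_eigen two_ne_zero lie_h₂_e₂)
    (of_eigen (by norm_num) lie_h₁_f₁) (of_eigen (by norm_num) lie_h₂_f₂) x

end Invariants

theorem exists_hasEigenvalue_not_hasEigenvalue_add_one {K V : Type*} [Field K] [IsAlgClosed K]
    [CharZero K] [AddCommGroup V] [Module K V] [FiniteDimensional K V] [Nontrivial V]
    (T : Module.End K V) : ∃ c, T.HasEigenvalue c ∧ ¬ T.HasEigenvalue (c + 1) := by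
  obtain ⟨c₀, hc₀⟩ := Module.End.exists_eigenvalue T
  by_contra! hstep
  have hall (n : ℕ) : T.HasEigenvalue (c₀ + n) := by
    induction n with
    | zero => simpa using hc₀
    | succ n ih => simpa [add_assoc] using hstep _ ih
  have hinj : Function.Injective fun n : ℕ => c₀ + (n : K) := fun m n h => by simpa using h
  exact Set.infinite_range_of_injective hinj
    ((Module.End.finite_hasEigenvalue T).subset (Set.range_subset_iff.2 hall))

theorem exists_common_eigenvector {K V : Type*} [Field K] [IsAlgClosed K] [AddCommGroup V]
    [Module K V] [FiniteDimensional K V] {T S : Module.End K V} (hcomm : Commute T S) {c : K}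
    (hc : T.HasEigenvalue c) : ∃ (v : V) (a : K), v ≠ 0 ∧ T v = c • v ∧ S v = a • v := by
  have hmaps : ∀ v ∈ T.eigenspace c, S v ∈ T.eigenspace c :=
    Module.End.mapsTo_genEigenspace_of_comm hcomm c 1
  have : Nontrivial (T.eigenspace c) := Submodule.nontrivial_iff_ne_bot.2 hc
  obtain ⟨a, ha⟩ := Module.End.exists_eigenvalue (S.restrict hmaps)
  obtain ⟨v, hv⟩ := ha.exists_hasEigenvector
  exact ⟨v, a, fun h => hv.2 (Subtype.ext h), Module.End.mem_eigenspace_iff.1 v.2,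
    congrArg Subtype.val hv.apply_eq_smul⟩

section Modules

variable {V : Type*} [AddCommGroup V] [Module ℂ V] [LieRingModule Sl3 V]

/-- A nonzero vector of weight `(a, b)`, in the basis of fundamental weights, that is killed by the
simple raising operators. -/
structure IsPrimitive (v : V) (a b : ℂ) : Prop where
  ne_zero : v ≠ 0
  lie_e₁ : ⁅e₁, v⁆ = 0
  lie_e₂ : ⁅e₂, v⁆ = 0
  lie_h₁ : ⁅h₁, v⁆ = a • v
  lie_h₂ : ⁅h₂, v⁆ = b • v

namespace IsPrimitive

variable {v : V} {a b : ℂ}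

theorem map {W : Type*} [AddCommGroup W] [Module ℂ W] [LieRingModule Sl3 W]
    (hv : IsPrimitive v a b) (φ : V →ₗ⁅ℂ,Sl3⁆ W) (hφ : φ v ≠ 0) : IsPrimitive (φ v) a b where
  ne_zero := hφ
  lie_e₁ := by rw [← LieModuleHom.map_lie, hv.lie_e₁, map_zero]
  lie_e₂ := by rw [← LieModuleHom.map_lie, hv.lie_e₂, map_zero]
  lie_h₁ := by rw [← LieModuleHom.map_lie, hv.lie_h₁, map_smul]
  lie_h₂ := by rw [← LieModuleHom.map_lie, hv.lie_h₂, map_smul]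

theorem add {w : V} (hv : IsPrimitive v a b) (hw : IsPrimitive w a b) (h : v + w ≠ 0) :
    IsPrimitive (v + w) a b where
  ne_zero := h
  lie_e₁ := by rw [lie_add, hv.lie_e₁, hw.lie_e₁, add_zero]
  lie_e₂ := by rw [lie_add, hv.lie_e₂, hw.lie_e₂, add_zero]
  lie_h₁ := by rw [lie_add, hv.lie_h₁, hw.lie_h₁, smul_add]
  lie_h₂ := by rw [lie_add, hv.lie_h₂, hw.lie_h₂, smul_add]

theorem hasPrimitiveVectorWith_h₁ (hv : IsPrimitive v a b) :
    isSl2Triple_h₁.HasPrimitiveVectorWith v a :=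
  ⟨hv.ne_zero, hv.lie_h₁, hv.lie_e₁⟩

theorem hasPrimitiveVectorWith_h₂ (hv : IsPrimitive v a b) :
    isSl2Triple_h₂.HasPrimitiveVectorWith v b :=
  ⟨hv.ne_zero, hv.lie_h₂, hv.lie_e₂⟩

theorem lie_tracelessUnit_self (hv : IsPrimitive v a b) :
    ⁅(tracelessUnit 0 0 : Sl3), v⁆ = ((2 * a + b) / 3) • v ∧
      ⁅(tracelessUnit 1 1 : Sl3), v⁆ = ((b - a) / 3) • v ∧
      ⁅(tracelessUnit 2 2 : Sl3), v⁆ = (-(a + 2 * b) / 3) • v := by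
  have sum_diag := congrArg (⁅·, v⁆) (sum_tracelessUnit_self (K := ℂ) (n := Fin 3))
  simp only [Fin.sum_univ_three, add_lie, zero_lie] at sum_diag
  have lie_h₁ := hv.lie_h₁
  have lie_h₂ := hv.lie_h₂
  rw [sub_lie] at lie_h₁ lie_h₂
  refine ⟨?_, ?_, ?_⟩
  · linear_combination (norm := module)
      (1 / 3 : ℂ) • sum_diag + (2 / 3 : ℂ) • lie_h₁ + (1 / 3 : ℂ) • lie_h₂
  · linear_combination (norm := module)
      (1 / 3 : ℂ) • sum_diag - (1 / 3 : ℂ) • lie_h₁ + (1 / 3 : ℂ) • lie_h₂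
  · linear_combination (norm := module)
      (1 / 3 : ℂ) • sum_diag - (1 / 3 : ℂ) • lie_h₁ - (2 / 3 : ℂ) • lie_h₂

variable [LieModule ℂ Sl3 V]

theorem exists_nat [FiniteDimensional ℂ V] (hv : IsPrimitive v a b) :
    ∃ m n : ℕ, a = m ∧ b = n := by
  obtain ⟨m, hm⟩ := hv.hasPrimitiveVectorWith_h₁.exists_nat
  obtain ⟨n, hn⟩ := hv.hasPrimitiveVectorWith_h₂.exists_nat
  exact ⟨m, n, hm, hn⟩

theorem lie_eq_zero [FiniteDimensional ℂ V] (hv : IsPrimitive v 0 0) (x : Sl3) : ⁅x, v⁆ = 0 :=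
  lie_eq_zero_of_chevalley hv.lie_e₁ hv.lie_e₂
    (by simpa using hv.hasPrimitiveVectorWith_h₁.pow_toEnd_f_eq_zero_of_eq_nat (n := 0) (by simp))
    (by simpa using hv.hasPrimitiveVectorWith_h₂.pow_toEnd_f_eq_zero_of_eq_nat (n := 0) (by simp))
    x

end IsPrimitive

/-- The eigenvalue of the Casimir operator on a primitive vector of weight `(a, b)`. -/
def casimirValue (a b : ℂ) : ℂ := (2 / 3) * (a ^ 2 + a * b + b ^ 2) + 2 * (a + b)

theorem casimirValue_natCast_eq_zero {m n : ℕ} (h : casimirValue m n = 0) : m = 0 ∧ n = 0 := by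
  have : ((m ^ 2 + m * n + n ^ 2 + 3 * (m + n) : ℕ) : ℂ) = 0 := by
    rw [casimirValue] at h
    push_cast
    linear_combination (3 / 2 : ℂ) * h
  have := Nat.cast_eq_zero.1 this
  constructor <;> nlinarith

variable [LieModule ℂ Sl3 V]

theorem IsPrimitive.casimir_eq {v : V} {a b : ℂ} (hv : IsPrimitive v a b) :
    casimir ℂ (Fin 3) V v = casimirValue a b • v := by
  have lie_e₃ : ⁅(tracelessUnit 0 2 : Sl3), v⁆ = 0 := by
    have : (tracelessUnit 0 2 : Sl3) = ⁅e₁, e₂⁆ := by simp [lie_tracelessUnit]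
    rw [this, lie_lie, hv.lie_e₁, hv.lie_e₂, lie_zero, lie_zero, sub_zero]
  have raise_lower {i j : Fin 3} (h : ⁅(tracelessUnit i j : Sl3), v⁆ = 0) :
      ⁅(tracelessUnit i j : Sl3), ⁅(tracelessUnit j i : Sl3), v⁆⁆ =
        ⁅(tracelessUnit i i : Sl3), v⁆ - ⁅(tracelessUnit j j : Sl3), v⁆ := by
    rw [leibniz_lie, h, lie_zero, add_zero, lie_tracelessUnit, if_pos rfl, if_pos rfl, sub_lie]
  obtain ⟨diag₀, diag₁, diag₂⟩ := hv.lie_tracelessUnit_self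
  simp only [casimir_apply, Fin.sum_univ_three, raise_lower hv.lie_e₁, raise_lower hv.lie_e₂,
    raise_lower lie_e₃, hv.lie_e₁, hv.lie_e₂, lie_e₃, diag₀, diag₁, diag₂, lie_smul, lie_zero,
    casimirValue]
  module

variable (V) in
/-- A vector of an eigenspace of `h₁ + h₂` whose eigenvalue is maximal along integral translates is
killed by `e₁` and `e₂`, since these raise the eigenvalue by one. -/
theorem exists_isPrimitive [FiniteDimensional ℂ V] [Nontrivial V] :
    ∃ (v : V) (m n : ℕ), IsPrimitive v (m : ℂ) (n : ℂ) := by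
  let T : Module.End ℂ V := LieModule.toEnd ℂ Sl3 V (h₁ + h₂)
  let S : Module.End ℂ V := LieModule.toEnd ℂ Sl3 V h₁
  obtain ⟨c, hc, hc_max⟩ := exists_hasEigenvalue_not_hasEigenvalue_add_one T
  have hcomm : Commute T S := by
    have : ⁅h₁ + h₂, h₁⁆ = 0 := by
      rw [add_lie, lie_self, ← lie_skew, lie_h₁_h₂, neg_zero, add_zero]
    refine LinearMap.ext fun u => show ⁅h₁ + h₂, ⁅h₁, u⁆⁆ = ⁅h₁, ⁅h₁ + h₂, u⁆⁆ from ?_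
    rw [leibniz_lie, this, zero_lie, zero_add]
  obtain ⟨v, a, hv_ne, hTv : ⁅h₁ + h₂, v⁆ = c • v, hSv : ⁅h₁, v⁆ = a • v⟩ :=
    exists_common_eigenvector hcomm hc
  have killed {x : Sl3} (hx : ⁅h₁ + h₂, x⁆ = x) : ⁅x, v⁆ = 0 := by
    by_contra hne
    refine hc_max (Module.End.hasEigenvalue_of_hasEigenvector (x := ⁅x, v⁆) ⟨?_, hne⟩)
    refine Module.End.mem_eigenspace_iff.2 (show ⁅h₁ + h₂, ⁅x, v⁆⁆ = _ from ?_)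
    rw [leibniz_lie, hx, hTv, lie_smul]
    module
  have hv : IsPrimitive v a (c - a) :=
    { ne_zero := hv_ne
      lie_e₁ := killed (by rw [add_lie, lie_h₁_e₁, lie_h₂_e₁]; module)
      lie_e₂ := killed (by rw [add_lie, lie_h₁_e₂, lie_h₂_e₂]; module)
      lie_h₁ := hSv
      lie_h₂ := by rw [add_lie, hSv] at hTv; rw [sub_smul, ← hTv]; abel }
  obtain ⟨m, n, hm, hn⟩ := hv.exists_nat
  exact ⟨v, m, n, hn ▸ hm ▸ hv⟩

end Modules

section Weyl

open LieModule (maxTrivSubmodule maxTrivLinearMapEquivLieModuleHom)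

variable {V W : Type*} [AddCommGroup V] [Module ℂ V] [LieRingModule Sl3 V] [LieModule ℂ Sl3 V]
  [AddCommGroup W] [Module ℂ W] [LieRingModule Sl3 W] [LieModule ℂ Sl3 W]

theorem map_casimir_pow (φ : V →ₗ⁅ℂ,Sl3⁆ W) (k : ℕ) (v : V) :
    φ ((casimir ℂ (Fin 3) V ^ k) v) = (casimir ℂ (Fin 3) W ^ k) (φ v) := by
  induction k generalizing v with
  | zero => rfl
  | succ k ih =>
    rw [pow_succ, pow_succ, Module.End.mul_apply, Module.End.mul_apply, ih, map_casimir]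

theorem casimir_pow_lie (k : ℕ) (x : Sl3) (v : V) :
    (casimir ℂ (Fin 3) V ^ k) ⁅x, v⁆ = ⁅x, (casimir ℂ (Fin 3) V ^ k) v⁆ := by
  induction k generalizing v with
  | zero => rfl
  | succ k ih => rw [pow_succ, Module.End.mul_apply, Module.End.mul_apply, casimir_lie, ih]

theorem IsPrimitive.lie_eq_zero_of_isNilpotent_casimir [FiniteDimensional ℂ V]
    (hV : IsNilpotent (casimir ℂ (Fin 3) V)) {v : V} {m n : ℕ}
    (hv : IsPrimitive v (m : ℂ) (n : ℂ)) (x : Sl3) : ⁅x, v⁆ = 0 := by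
  have heigen : (casimir ℂ (Fin 3) V).HasEigenvector (casimirValue m n) v :=
    ⟨Module.End.mem_eigenspace_iff.2 hv.casimir_eq, hv.ne_zero⟩
  obtain ⟨k, hk⟩ := hV
  have hpow : casimirValue m n ^ k • v = 0 := by rw [← heigen.pow_apply, hk, LinearMap.zero_apply]
  have hzero : casimirValue m n = 0 :=
    eq_zero_of_pow_eq_zero ((smul_eq_zero_iff_left hv.ne_zero).1 hpow)
  obtain ⟨rfl, rfl⟩ := casimirValue_natCast_eq_zero hzero
  exact IsPrimitive.lie_eq_zero (by simpa using hv) x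

/-- Otherwise a primitive vector of the quotient by the invariants would be invariant, and any lift
of it would be invariant because `sl₃` is perfect. -/
theorem lie_eq_zero_of_isNilpotent_casimir [FiniteDimensional ℂ V]
    (hV : IsNilpotent (casimir ℂ (Fin 3) V)) (x : Sl3) (v : V) : ⁅x, v⁆ = 0 := by
  let I := maxTrivSubmodule ℂ Sl3 V
  suffices I = ⊤ from (this ▸ LieSubmodule.mem_top v : v ∈ I) x
  by_contra hI
  have : Nontrivial (V ⧸ I) :=
    Submodule.Quotient.nontrivial_iff.2 fun h => hI (LieSubmodule.toSubmodule_injective h)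
  have hquot : IsNilpotent (casimir ℂ (Fin 3) (V ⧸ I)) := by
    obtain ⟨k, hk⟩ := hV
    refine ⟨k, LinearMap.ext fun q => ?_⟩
    obtain ⟨u, rfl⟩ := LieSubmodule.Quotient.surjective_mk' I q
    rw [← map_casimir_pow, hk, LinearMap.zero_apply, map_zero, LinearMap.zero_apply]
  obtain ⟨q, m, n, hq⟩ := exists_isPrimitive (V ⧸ I)
  obtain ⟨u, rfl⟩ := LieSubmodule.Quotient.surjective_mk' I q
  have lie_mem (y : Sl3) : ⁅y, u⁆ ∈ I := by
    rw [← LieSubmodule.Quotient.mk_eq_zero I, LieModuleHom.map_lie]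
    exact hq.lie_eq_zero_of_isNilpotent_casimir hquot y
  have hu : u ∈ I := lie_eq_zero_of_forall_lie_lie fun y z => by
    rw [lie_lie, lie_mem z y, lie_mem y z, sub_zero]
  exact hq.ne_zero ((LieSubmodule.Quotient.mk_eq_zero I).2 hu)

/-- Lift the invariant arbitrarily, and discard the component of the lift in the positive Fitting
component of the Casimir operator; on the remaining component the action is trivial. -/
theorem exists_invariant_lift [FiniteDimensional ℂ V] [FiniteDimensional ℂ W]
    {φ : V →ₗ⁅ℂ,Sl3⁆ W} (hφ : Function.Surjective φ) {w : W} (hw : ∀ x : Sl3, ⁅x, w⁆ = 0) :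
    ∃ v, (∀ x : Sl3, ⁅x, v⁆ = 0) ∧ φ v = w := by
  let c := casimir ℂ (Fin 3) V
  let d := casimir ℂ (Fin 3) W
  obtain ⟨k, ⟨hV, hW⟩, hk⟩ :=
    ((c.eventually_isCompl_ker_pow_range_pow.and d.eventually_isCompl_ker_pow_range_pow).and
      (Filter.eventually_ne_atTop 0)).exists
  have dw_eq_zero : (d ^ k) w = 0 := by
    have : d w = 0 := by simp [d, casimir_apply, hw]
    rw [← Nat.succ_pred_eq_of_ne_zero hk, pow_succ, Module.End.mul_apply, this, map_zero]
  obtain ⟨u, rfl⟩ := hφ w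
  obtain ⟨v, r, hv, ⟨s, hs⟩, rfl⟩ := Submodule.codisjoint_iff_exists_add_eq.1 hV.codisjoint u
  have hr : φ r = 0 := by
    refine Submodule.disjoint_def.1 hW.disjoint _ (LinearMap.mem_ker.2 ?_)
      ⟨φ s, by rw [← map_casimir_pow, ← hs]⟩
    rwa [map_add, map_add, ← map_casimir_pow φ k v, LinearMap.mem_ker.1 hv, map_zero,
      zero_add] at dw_eq_zero
  let N : LieSubmodule ℂ Sl3 V :=
    { LinearMap.ker (c ^ k) with
      lie_mem := fun {x m} (hm : (c ^ k) m = 0) =>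
        show (c ^ k) ⁅x, m⁆ = 0 by rw [casimir_pow_lie, hm, lie_zero] }
  have hN : IsNilpotent (casimir ℂ (Fin 3) N) :=
    ⟨k, LinearMap.ext fun m => Subtype.ext ((map_casimir_pow N.incl k m).trans m.2)⟩
  refine ⟨v, fun x => ?_, by rw [map_add, hr, add_zero]⟩
  exact congrArg Subtype.val (lie_eq_zero_of_isNilpotent_casimir hN x ⟨v, hv⟩)

/-- A Lie retraction onto `N` is an invariant lift of the identity along the restriction map
`Hom(V, N) → Hom(N, N)`. -/
theorem exists_lieModuleHom_retraction [FiniteDimensional ℂ V] (N : LieSubmodule ℂ Sl3 V) :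
    ∃ r : V →ₗ⁅ℂ,Sl3⁆ N, ∀ v : N, r v = v := by
  let restrict : (V →ₗ[ℂ] N) →ₗ⁅ℂ,Sl3⁆ (N →ₗ[ℂ] N) :=
    { toFun := fun g => g ∘ₗ (N : Submodule ℂ V).subtype
      map_add' := fun _ _ => rfl
      map_smul' := fun _ _ => rfl
      map_lie' := rfl }
  have hsurj : Function.Surjective restrict := LinearMap.exists_extend
  obtain ⟨r, hr, hr_restrict⟩ := exists_invariant_lift hsurj (w := LinearMap.id) fun x => by
    ext v
    simp
  exact ⟨maxTrivLinearMapEquivLieModuleHom ⟨r, hr⟩, LinearMap.congr_fun hr_restrict⟩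

end Weyl

namespace FDLieMod

variable {L : Type} [LieRing L] [LieAlgebra ℂ L]

theorem isIso_of_bijective {V W : FDLieMod L} (f : V ⟶ W) (h : Function.Bijective (toLie f)) :
    IsIso f :=
  (isoOfEquiv { LinearEquiv.ofBijective (toLie f : V →ₗ[ℂ] W) h with
    map_lie' := fun {x v} => (toLie f).map_lie x v }).isIso_hom

instance finite_hom (V W : FDLieMod L) : Module.Finite ℂ (V ⟶ W) :=
  Module.Finite.of_injective
    ({ toFun := fun f => (toLie f : V →ₗ[ℂ] W), map_add' := fun _ _ => rfl,
       map_smul' := fun _ _ => rfl } : (V ⟶ W) →ₗ[ℂ] (V →ₗ[ℂ] W))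
    fun _ _ h => hom_ext fun v => LinearMap.congr_fun h v

/-- A Lie submodule, as an object. -/
def ofSubmodule {V : FDLieMod L} (N : LieSubmodule ℂ L V) : FDLieMod L where
  carrier := N

theorem isZero_of_subsingleton (V : FDLieMod L) [Subsingleton V] : IsZero V :=
  (IsZero.iff_id_eq_zero V).2 (hom_ext fun _ => Subsingleton.elim _ _)

theorem subsingleton_of_isZero {V : FDLieMod L} (h : IsZero V) : Subsingleton V :=
  subsingleton_of_forall_eq 0 fun v =>
    congrArg (fun f => toLie f v) ((IsZero.iff_id_eq_zero V).1 h)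

theorem eq_bot_of_isZero_ofSubmodule {V : FDLieMod L} {N : LieSubmodule ℂ L V}
    (h : IsZero (ofSubmodule N)) : N = ⊥ :=
  not_not.1 fun hN => not_nontrivial_iff_subsingleton.2 (subsingleton_of_isZero h)
    ((LieSubmodule.nontrivial_iff_ne_bot ℂ L V).2 hN)

/-! ### Irreducible modules -/

theorem injective_of_ne_zero {V W : FDLieMod L} [LieModule.IsIrreducible ℂ L V] {f : V ⟶ W}
    (hf : f ≠ 0) : Function.Injective (toLie f) := by
  refine (LieModuleHom.ker_eq_bot (toLie f)).1 <|
    (eq_bot_or_eq_top _).resolve_right fun h => hf (hom_ext fun v => ?_)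
  exact LieModuleHom.mem_ker.1 (h ▸ LieSubmodule.mem_top v)

theorem isIso_of_ne_zero {V W : FDLieMod L} [LieModule.IsIrreducible ℂ L V]
    [LieModule.IsIrreducible ℂ L W] {f : V ⟶ W} (hf : f ≠ 0) : IsIso f := by
  refine isIso_of_bijective f ⟨injective_of_ne_zero hf, (LieModuleHom.range_eq_top (toLie f)).1 ?_⟩
  refine (eq_bot_or_eq_top _).resolve_left fun h => hf (hom_ext fun v => ?_)
  exact (LieSubmodule.mem_bot _).1 (h ▸ ((toLie f).mem_range _).2 ⟨v, rfl⟩)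

theorem isLocalRing_end_of_isIrreducible (V : FDLieMod L) [LieModule.IsIrreducible ℂ L V] :
    IsLocalRing (End V) where
  exists_pair_ne := by
    have : Nontrivial V := LieModule.nontrivial_of_isIrreducible ℂ L V
    obtain ⟨v, hv⟩ := exists_ne (0 : V)
    exact ⟨0, 1, fun h => hv (congrArg (fun f : V ⟶ V => toLie f v) h).symm⟩
  isUnit_or_isUnit_of_add_one {a b} h := by
    by_cases ha : a = 0
    · exact .inr (by rw [← zero_add b, ← ha, h]; exact isUnit_one)
    · exact .inl ((isUnit_iff_isIso a).2 (isIso_of_ne_zero ha))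

theorem isIrreducible_ofSubmodule_of_isAtom {V : FDLieMod L} {N : LieSubmodule ℂ L V}
    (hN : IsAtom N) : LieModule.IsIrreducible ℂ L (ofSubmodule N) := by
  have : Nontrivial N := (LieSubmodule.nontrivial_iff_ne_bot ℂ L V).2 hN.1
  have : LieModule.IsIrreducible ℂ L N := LieModule.IsIrreducible.mk fun K hK => by
    by_contra hK_top
    have hmap : K.map N.incl = ⊥ :=
      hN.2 _ (LieSubmodule.map_incl_lt_iff_lt_top.2 (lt_top_iff_ne_top.2 hK_top))
    refine hK ((LieSubmodule.eq_bot_iff K).2 fun v hv => Subtype.ext ?_)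
    exact (LieSubmodule.mem_bot _).1 (hmap ▸ LieSubmodule.mem_map_of_mem hv)
  exact this

instance isIrreducible_triv : LieModule.IsIrreducible ℂ L (triv : FDLieMod L) := by
  have : Nontrivial (triv : FDLieMod L) := inferInstanceAs (Nontrivial ℂ)
  have : IsSimpleOrder (Submodule ℂ (triv : FDLieMod L)) :=
    inferInstanceAs (IsSimpleOrder (Submodule ℂ ℂ))
  exact LieModule.IsIrreducible.mk fun N hN => LieSubmodule.toSubmodule_injective
    ((eq_bot_or_eq_top N.toSubmodule).resolve_left fun h => hN (N.toSubmodule_eq_bot.1 h))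

theorem indecomposable_unit : Indecomposable (𝟙_ (FDLieMod L)) :=
  have := isLocalRing_end_of_isIrreducible (triv : FDLieMod L)
  indecomposable_of_isLocalRing_end (𝟙_ (FDLieMod L))

/-! ### Complete reducibility -/

/-- Every submodule of a finite dimensional `L`-module is a direct summand. -/
class IsCompletelyReducible (L : Type) [LieRing L] [LieAlgebra ℂ L] : Prop where
  exists_retraction {V : FDLieMod L} (N : LieSubmodule ℂ L V) :
    ∃ r : V →ₗ⁅ℂ,L⁆ N, ∀ v : N, r v = v

/-- The decomposition `V ≅ N ⊞ ker r` given by a retraction `r` onto a submodule `N`. -/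
def isoBiprodOfRetraction {V : FDLieMod L} {N : LieSubmodule ℂ L V} (r : V →ₗ⁅ℂ,L⁆ N)
    (hr : ∀ v : N, r v = v) : V ≅ ofSubmodule N ⊞ ofSubmodule r.ker :=
  let fromN : ofSubmodule N ⟶ V := ofLie (V := ofSubmodule N) N.incl
  let fromKer : ofSubmodule r.ker ⟶ V := ofLie (V := ofSubmodule r.ker) r.ker.incl
  let toN : V ⟶ ofSubmodule N := ofLie (W := ofSubmodule N) r
  let toKer : V ⟶ ofSubmodule r.ker := ofLie (W := ofSubmodule r.ker)
    ((LieModuleHom.id - N.incl.comp r).codRestrict r.ker fun v => by simp [hr])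
  { hom := biprod.lift toN toKer
    inv := biprod.desc fromN fromKer
    hom_inv_id := by
      rw [biprod.lift_desc]
      exact hom_ext fun v => add_sub_cancel (r v : V) v
    inv_hom_id := by
      have fromN_toN : fromN ≫ toN = 𝟙 _ := hom_ext hr
      have fromN_toKer : fromN ≫ toKer = 0 := hom_ext fun v => Subtype.ext <|
        sub_eq_zero.2 (congrArg Subtype.val (hr v)).symm
      have fromKer_toN : fromKer ≫ toN = 0 := hom_ext fun v => v.2
      have fromKer_toKer : fromKer ≫ toKer = 𝟙 _ := hom_ext fun v => Subtype.ext <|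
        (congrArg (fun n : N => v.1 - n) v.2).trans (sub_zero v.1)
      ext <;> simp [fromN_toN, fromN_toKer, fromKer_toN, fromKer_toKer] }

section CompletelyReducible

variable [IsCompletelyReducible L]

theorem isIrreducible_of_indecomposable {V : FDLieMod L} (hV : Indecomposable V) :
    LieModule.IsIrreducible ℂ L V := by
  have : Nontrivial V :=
    not_subsingleton_iff_nontrivial.1 fun _ => hV.1 (isZero_of_subsingleton V)
  refine LieModule.IsIrreducible.mk fun N hN => ?_
  obtain ⟨r, hr⟩ := IsCompletelyReducible.exists_retraction N
  have hker : r.ker = ⊥ := (hV.2 _ _ (isoBiprodOfRetraction r hr)).elim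
    (fun h => absurd (eq_bot_of_isZero_ofSubmodule h) hN) eq_bot_of_isZero_ofSubmodule
  refine eq_top_iff.2 fun v _ => ?_
  rw [← (LieModuleHom.ker_eq_bot r).1 hker (hr (r v))]
  exact (r v).2

instance : IsSemisimpleCategory (FDLieMod L) where
  isIso_of_ne_zero hX hY _ hf :=
    have := isIrreducible_of_indecomposable hX
    have := isIrreducible_of_indecomposable hY
    isIso_of_ne_zero hf

theorem isKrullSchmidt : IsKrullSchmidt (FDLieMod L) := by
  intro V
  induction hd : Module.finrank ℂ V using Nat.strong_induction_on generalizing V with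
  | _ d ih =>
    rcases subsingleton_or_nontrivial V with hV | hV
    · exact ⟨0, Fin.elim0, fun i => i.elim0,
        ⟨(isZero_of_subsingleton V).iso (isZero_biproduct_fin_zero _)⟩⟩
    obtain ⟨N, hN⟩ := IsAtomic.exists_atom (LieSubmodule ℂ L V)
    obtain ⟨r, hr⟩ := IsCompletelyReducible.exists_retraction N
    have hker : r.ker.toSubmodule ≠ ⊤ := fun h => hN.1 <| (LieSubmodule.eq_bot_iff N).2 fun v hv =>
      congrArg Subtype.val ((hr ⟨v, hv⟩).symm.trans (h.ge trivial))
    obtain ⟨n, Y, hY, ⟨e⟩⟩ := ih _ (hd ▸ Submodule.finrank_lt hker) (ofSubmodule r.ker) rfl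
    have := isIrreducible_ofSubmodule_of_isAtom hN
    exact ⟨n + 1, Fin.cons (ofSubmodule N) Y,
      Fin.cases (isLocalRing_end_of_isIrreducible (ofSubmodule N)) hY,
      ⟨isoBiprodOfRetraction r hr ≪≫ biprod.mapIso (Iso.refl _) e ≪≫
        (biproductFinSuccIso (Fin.cons (ofSubmodule N) Y : Fin (n + 1) → FDLieMod L)).symm⟩⟩

instance : Fact (IsKrullSchmidt (FDLieMod L)) := ⟨isKrullSchmidt⟩

end CompletelyReducible

/-! ### Bilinearity and duals -/

instance : IsBilinearAction (FDLieMod L) (FDLieMod L) where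
  actionHomRight_add _ {_ _} _ _ := tensor_hom_ext fun _ _ => TensorProduct.tmul_add _ _ _
  actionHomRight_smul _ {_ _} _ _ := tensor_hom_ext fun _ _ => TensorProduct.tmul_smul _ _ _
  add_actionHomLeft {_ _} _ _ _ := tensor_hom_ext fun _ _ => TensorProduct.add_tmul _ _ _
  smul_actionHomLeft {_ _} _ _ _ := tensor_hom_ext fun _ _ => rfl

/-- The pairing of the dual of a module with the module. -/
def dualPairing (V : FDLieMod L) : tensor V.dual V →ₗ⁅ℂ,L⁆ (triv : FDLieMod L) :=
  { (contractLeft ℂ V : _ →ₗ[ℂ] ℂ) with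
    map_lie' := fun {x t} =>
      map_lie_of_tmul (V := V.dual) (W := V) (X := triv) (contractLeft ℂ V : _ →ₗ[ℂ] ℂ)
        (fun x φ v => by
          change -(show V →ₗ[ℂ] ℂ from φ) ⁅x, v⁆ + (show V →ₗ[ℂ] ℂ from φ) ⁅x, v⁆ = 0
          ring) x t }

theorem lie_coevaluation (V : FDLieMod L) (x : L) (c : ℂ) :
    ⁅x, (coevaluation ℂ V c : tensor V V.dual)⁆ = 0 := by
  let endV : FDLieMod L := ⟨V →ₗ[ℂ] V⟩
  let toEnd : TensorProduct ℂ V (Module.Dual ℂ V) ≃ₗ[ℂ] (V →ₗ[ℂ] V) :=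
    TensorProduct.comm ℂ V (Module.Dual ℂ V) ≪≫ₗ dualTensorHomEquiv ℂ V V
  have toEnd_lie (t : tensor V V.dual) : toEnd ⁅x, t⁆ = ⁅x, toEnd t⁆ := by
    refine map_lie_of_tmul (V := V) (W := V.dual) (X := endV) toEnd.toLinearMap ?_ x t
    intro x v (φ : V →ₗ[ℂ] ℂ)
    refine LinearMap.ext fun u => ?_
    change φ u • ⁅x, v⁆ + -φ ⁅x, u⁆ • v = ⁅x, φ u • v⁆ - φ ⁅x, u⁆ • v
    rw [lie_smul, neg_smul, sub_eq_add_neg]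
  have toEnd_coevaluation : toEnd (coevaluation ℂ V c) = c • LinearMap.id := by
    ext u
    rw [← mul_one c, ← smul_eq_mul, map_smul, map_smul, coevaluation_apply_one]
    simpa [toEnd] using congrArg (c • ·) ((Module.Basis.ofVectorSpace ℂ V).sum_repr u)
  refine toEnd.injective ((toEnd_lie _).trans ?_)
  rw [toEnd_coevaluation, map_zero, lie_smul]
  exact (congrArg (c • ·) (LinearMap.ext fun u => sub_self ⁅x, u⁆)).trans (smul_zero c)

/-- The pairing of a module with its dual is perfect, with copairing the identity of `V` seen as an
element of `V ⊗ V*`. -/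
instance exactPairingDual (V : FDLieMod L) : ExactPairing V V.dual where
  coevaluation' := ofLie (V := triv) (W := tensor V V.dual)
    { (coevaluation ℂ V : ℂ →ₗ[ℂ] TensorProduct ℂ V (Module.Dual ℂ V)) with
      map_lie' := fun {x c} => (map_zero (coevaluation ℂ V)).trans (lie_coevaluation V x c).symm }
  evaluation' := ofLie (V := tensor V.dual V) (W := triv) (dualPairing V)
  coevaluation_evaluation' := hom_ext (LinearMap.congr_fun (contractLeft_assoc_coevaluation ℂ V))
  evaluation_coevaluation' := hom_ext (LinearMap.congr_fun (contractLeft_assoc_coevaluation' ℂ V))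

instance : RightRigidCategory (FDLieMod L) where
  rightDual V := { rightDual := V.dual, exact := exactPairingDual V }

end FDLieMod

instance : FDLieMod.IsCompletelyReducible Sl3 where
  exists_retraction := exists_lieModuleHom_retraction

section Lowering

variable {V : Type*} [AddCommGroup V] [Module ℂ V] [LieRingModule Sl3 V] [LieModule ℂ Sl3 V]

/-- The span of the vectors obtained from `p` by applying `n` simple lowering operators. -/
def loweringSpan (p : V) : ℕ → Submodule ℂ V
  | 0 => ℂ ∙ p
  | n + 1 => (loweringSpan p n).map (LieModule.toEnd ℂ Sl3 V f₁) ⊔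
      (loweringSpan p n).map (LieModule.toEnd ℂ Sl3 V f₂)

theorem loweringSpan_succ_le_iff {p : V} {n : ℕ} {N : Submodule ℂ V} :
    loweringSpan p (n + 1) ≤ N ↔ (∀ u ∈ loweringSpan p n, ⁅f₁, u⁆ ∈ N) ∧
      ∀ u ∈ loweringSpan p n, ⁅f₂, u⁆ ∈ N := by
  rw [loweringSpan, sup_le_iff, Submodule.map_le_iff_le_comap, Submodule.map_le_iff_le_comap]
  rfl

theorem lie_f₁_mem_loweringSpan {p u : V} {n : ℕ} (hu : u ∈ loweringSpan p n) :
    ⁅f₁, u⁆ ∈ loweringSpan p (n + 1) :=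
  (loweringSpan_succ_le_iff.1 le_rfl).1 u hu

theorem lie_f₂_mem_loweringSpan {p u : V} {n : ℕ} (hu : u ∈ loweringSpan p n) :
    ⁅f₂, u⁆ ∈ loweringSpan p (n + 1) :=
  (loweringSpan_succ_le_iff.1 le_rfl).2 u hu

theorem lie_mem_loweringSpan_of_weight {p : V} {x : Sl3} {c d₁ d₂ : ℂ} (hp : ⁅x, p⁆ = c • p)
    (hf₁ : ⁅x, f₁⁆ = d₁ • f₁) (hf₂ : ⁅x, f₂⁆ = d₂ • f₂) (n : ℕ) :
    ∀ u ∈ loweringSpan p n, ⁅x, u⁆ ∈ loweringSpan p n := by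
  induction n with
  | zero =>
    rintro u hu
    obtain ⟨r, rfl⟩ := Submodule.mem_span_singleton.1 hu
    rw [lie_smul, hp]
    exact Submodule.smul_mem _ r (Submodule.smul_mem _ c (Submodule.mem_span_singleton_self p))
  | succ n ih =>
    refine loweringSpan_succ_le_iff (N := (loweringSpan p (n + 1)).comap
      (LieModule.toEnd ℂ Sl3 V x)).2 ⟨fun u hu => ?_, fun u hu => ?_⟩
    · rw [Submodule.mem_comap, LieModule.toEnd_apply_apply, leibniz_lie, hf₁, smul_lie]
      exact add_mem (Submodule.smul_mem _ _ (lie_f₁_mem_loweringSpan hu))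
        (lie_f₁_mem_loweringSpan (ih u hu))
    · rw [Submodule.mem_comap, LieModule.toEnd_apply_apply, leibniz_lie, hf₂, smul_lie]
      exact add_mem (Submodule.smul_mem _ _ (lie_f₂_mem_loweringSpan hu))
        (lie_f₂_mem_loweringSpan (ih u hu))

theorem lie_mem_loweringSpan_of_raising {p : V} {x : Sl3} (hp : ⁅x, p⁆ = 0)
    (hf₁ : ∀ n, ∀ u ∈ loweringSpan p n, ⁅⁅x, f₁⁆, u⁆ ∈ loweringSpan p n)
    (hf₂ : ∀ n, ∀ u ∈ loweringSpan p n, ⁅⁅x, f₂⁆, u⁆ ∈ loweringSpan p n) (n : ℕ) :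
    ∀ u ∈ loweringSpan p (n + 1), ⁅x, u⁆ ∈ loweringSpan p n := by
  have raise_lower (n : ℕ) (ih : ∀ u ∈ loweringSpan p n, ⁅f₁, ⁅x, u⁆⁆ ∈ loweringSpan p n ∧
      ⁅f₂, ⁅x, u⁆⁆ ∈ loweringSpan p n) :
      ∀ u ∈ loweringSpan p (n + 1), ⁅x, u⁆ ∈ loweringSpan p n := by
    refine loweringSpan_succ_le_iff (N := (loweringSpan p n).comap
      (LieModule.toEnd ℂ Sl3 V x)).2 ⟨fun u hu => ?_, fun u hu => ?_⟩
    · rw [Submodule.mem_comap, LieModule.toEnd_apply_apply, leibniz_lie]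
      exact add_mem (hf₁ n u hu) (ih u hu).1
    · rw [Submodule.mem_comap, LieModule.toEnd_apply_apply, leibniz_lie]
      exact add_mem (hf₂ n u hu) (ih u hu).2
  induction n with
  | zero =>
    refine raise_lower 0 fun u hu => ?_
    obtain ⟨r, rfl⟩ := Submodule.mem_span_singleton.1 hu
    simp [lie_smul, hp]
  | succ n ih =>
    exact raise_lower (n + 1) fun u hu =>
      ⟨lie_f₁_mem_loweringSpan (ih u hu), lie_f₂_mem_loweringSpan (ih u hu)⟩

namespace IsPrimitive

variable {p : V} {a b : ℂ}

theorem loweringSpan_le_eigenspace (hp : IsPrimitive p a b) (n : ℕ) : loweringSpan p n ≤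
    (LieModule.toEnd ℂ Sl3 V (h₁ + h₂)).eigenspace (a + b - n) := by
  have lower {f : Sl3} (hf : ⁅h₁ + h₂, f⁆ = (-1 : ℂ) • f) {n : ℕ} {u : V}
      (hu : ⁅h₁ + h₂, u⁆ = (a + b - n) • u) :
      ⁅h₁ + h₂, ⁅f, u⁆⁆ = (a + b - (n + 1 : ℕ)) • ⁅f, u⁆ := by
    rw [leibniz_lie, hf, hu, lie_smul, smul_lie]
    push_cast
    module
  induction n with
  | zero =>
    refine (Submodule.span_singleton_le_iff_mem _ _).2 (Module.End.mem_eigenspace_iff.2 ?_)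
    rw [LieModule.toEnd_apply_apply, add_lie, hp.lie_h₁, hp.lie_h₂]
    module
  | succ n ih =>
    refine loweringSpan_succ_le_iff.2 ⟨fun u hu => ?_, fun u hu => ?_⟩ <;>
      refine Module.End.mem_eigenspace_iff.2
        (lower ?_ (Module.End.mem_eigenspace_iff.1 (ih hu)))
    · rw [add_lie, lie_h₁_f₁, lie_h₂_f₁]; module
    · rw [add_lie, lie_h₁_f₂, lie_h₂_f₂]; module

/-- The submodule generated by a primitive vector. -/
def cyclic (hp : IsPrimitive p a b) : LieSubmodule ℂ Sl3 V where
  toSubmodule := ⨆ n, loweringSpan p n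
  lie_mem {x v} hv := by
    have iSup_stable {x : Sl3} (hx : ∀ n, ∀ u ∈ loweringSpan p n,
        ⁅x, u⁆ ∈ ⨆ n, loweringSpan p n) :
        ∀ u ∈ ⨆ n, loweringSpan p n, ⁅x, u⁆ ∈ ⨆ n, loweringSpan p n :=
      iSup_le (a := (⨆ n, loweringSpan p n).comap (LieModule.toEnd ℂ Sl3 V x)) hx
    have hh₁ := lie_mem_loweringSpan_of_weight hp.lie_h₁ lie_h₁_f₁ lie_h₁_f₂
    have hh₂ := lie_mem_loweringSpan_of_weight hp.lie_h₂ lie_h₂_f₁ lie_h₂_f₂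
    have he₁ := lie_mem_loweringSpan_of_raising hp.lie_e₁ (by rwa [lie_e₁_f₁])
      (by simp [lie_e₁_f₂])
    have he₂ := lie_mem_loweringSpan_of_raising hp.lie_e₂ (by simp [lie_e₂_f₁])
      (by rwa [lie_e₂_f₂])
    have raise_iSup {x : Sl3} (hx : ⁅x, p⁆ = 0)
        (h : ∀ n, ∀ u ∈ loweringSpan p (n + 1), ⁅x, u⁆ ∈ loweringSpan p n) :
        ∀ u ∈ ⨆ n, loweringSpan p n, ⁅x, u⁆ ∈ ⨆ n, loweringSpan p n := by
      refine iSup_stable fun n u hu => ?_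
      cases n with
      | zero =>
        obtain ⟨r, rfl⟩ := Submodule.mem_span_singleton.1 hu
        simp [lie_smul, hx]
      | succ n => exact Submodule.mem_iSup_of_mem n (h n u hu)
    exact lie_mem_of_chevalley_stable (raise_iSup hp.lie_e₁ he₁) (raise_iSup hp.lie_e₂ he₂)
      (iSup_stable fun n _ hu => Submodule.mem_iSup_of_mem (n + 1) (lie_f₁_mem_loweringSpan hu))
      (iSup_stable fun n _ hu => Submodule.mem_iSup_of_mem (n + 1) (lie_f₂_mem_loweringSpan hu))
      x hv

theorem mem_cyclic (hp : IsPrimitive p a b) : p ∈ hp.cyclic :=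
  Submodule.mem_iSup_of_mem 0 (Submodule.mem_span_singleton_self p)

theorem mem_span_of_mem_cyclic (hp : IsPrimitive p a b) {q : V} (hq : IsPrimitive q a b)
    (hmem : q ∈ hp.cyclic) : q ∈ ℂ ∙ p := by
  let T := LieModule.toEnd ℂ Sl3 V (h₁ + h₂)
  have hmem : q ∈ loweringSpan p 0 ⊔ ⨆ n, loweringSpan p (n + 1) := by
    rwa [sup_iSup_nat_succ]
  obtain ⟨s, hs, t, ht, rfl⟩ := Submodule.mem_sup.1 hmem
  have ht_top : t ∈ T.eigenspace (a + b) := by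
    have hq_top := hq.loweringSpan_le_eigenspace 0 (Submodule.mem_span_singleton_self _)
    have := sub_mem hq_top (hp.loweringSpan_le_eigenspace 0 hs)
    rwa [add_sub_cancel_left, Nat.cast_zero, sub_zero] at this
  have lower_le : ⨆ n, loweringSpan p (n + 1) ≤ ⨆ c ≠ a + b, T.eigenspace c := by
    refine iSup_le fun n => ?_
    refine (hp.loweringSpan_le_eigenspace (n + 1)).trans (le_iSup₂_of_le _ ?_ le_rfl)
    rw [Ne, sub_eq_self]
    exact Nat.cast_ne_zero.2 n.succ_ne_zero
  have : t = 0 :=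
    Submodule.disjoint_def.1 (T.eigenspaces_iSupIndep (a + b)) t ht_top (lower_le ht)
  rwa [this, add_zero]

end IsPrimitive

end Lowering

namespace FDLieMod

theorem nonempty_retract_of_injective {L : Type} [LieRing L] [LieAlgebra ℂ L]
    [IsCompletelyReducible L] {V W : FDLieMod L} (f : V ⟶ W)
    (hf : Function.Injective (toLie f)) : Nonempty (Retract V W) := by
  obtain ⟨r, hr⟩ := IsCompletelyReducible.exists_retraction (toLie f).range
  let retraction : W ⟶ ofSubmodule (toLie f).range := ofLie (W := ofSubmodule (toLie f).range) r
  have : IsIso (f ≫ retraction) := isIso_of_bijective _ <| by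
    have apply_eq (v : V) : toLie (f ≫ retraction) v =
        (⟨toLie f v, (LieModuleHom.mem_range _ _).2 ⟨v, rfl⟩⟩ : (toLie f).range) :=
      hr ⟨toLie f v, _⟩
    refine ⟨fun x y hxy => hf ?_, ?_⟩
    · exact congrArg Subtype.val ((apply_eq x).symm.trans (hxy.trans (apply_eq y)))
    · rintro ⟨_, hy⟩
      obtain ⟨v, rfl⟩ := (LieModuleHom.mem_range _ _).1 hy
      exact ⟨v, apply_eq v⟩
  exact ⟨f, retraction ≫ inv (f ≫ retraction), by rw [← Category.assoc, IsIso.hom_inv_id]⟩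

/-- If `p = (v, w)` generates `K ⊆ V ⊞ W`, then `V` is a summand of `K` through a map sending `v` to
a multiple of `p`, since these are the only vectors of `K` of the same weight. -/
theorem exists_hom_apply_ne_zero_of_isPrimitive {V W : FinSl3} (hV : Indecomposable V)
    {v : V} {w : W} {a b : ℂ} (hv : IsPrimitive v a b) (hw : IsPrimitive w a b) :
    ∃ φ : V ⟶ W, toLie φ v ≠ 0 := by
  have inl_fst : toLie (biprod.fst : V ⊞ W ⟶ V) (toLie biprod.inl v) = v :=
    congrArg (fun f => toLie f v) biprod.inl_fst
  have inl_snd : toLie (biprod.snd : V ⊞ W ⟶ W) (toLie biprod.inl v) = 0 :=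
    congrArg (fun f => toLie f v) biprod.inl_snd
  have inr_fst : toLie (biprod.fst : V ⊞ W ⟶ V) (toLie biprod.inr w) = 0 :=
    congrArg (fun f => toLie f w) biprod.inr_fst
  have inr_snd : toLie (biprod.snd : V ⊞ W ⟶ W) (toLie biprod.inr w) = w :=
    congrArg (fun f => toLie f w) biprod.inr_snd
  let p : (V ⊞ W : FinSl3) := toLie biprod.inl v + toLie biprod.inr w
  have fst_p : toLie biprod.fst p = v := by rw [map_add, inl_fst, inr_fst, add_zero]
  have snd_p : toLie biprod.snd p = w := by rw [map_add, inl_snd, inr_snd, zero_add]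
  have ne_zero_of_map {X Y : FinSl3} (f : X ⟶ Y) {x : X} (h : toLie f x ≠ 0) : x ≠ 0 :=
    fun hx => h (by rw [hx, map_zero])
  have hp : IsPrimitive p a b := .add
    (hv.map _ (ne_zero_of_map biprod.fst (by rw [inl_fst]; exact hv.ne_zero)))
    (hw.map _ (ne_zero_of_map biprod.snd (by rw [inr_snd]; exact hw.ne_zero)))
    (ne_zero_of_map biprod.fst (by rw [fst_p]; exact hv.ne_zero))
  let incl : ofSubmodule hp.cyclic ⟶ V ⊞ W := ofLie (V := ofSubmodule hp.cyclic) hp.cyclic.incl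
  have hfst : incl ≫ biprod.fst ≠ 0 := fun h => hv.ne_zero <| fst_p.symm.trans <|
    congrArg (fun f => toLie f (⟨p, hp.mem_cyclic⟩ : hp.cyclic)) h
  obtain ⟨s⟩ := nonempty_retract_of_ne_zero hV hfst
  have section_v_ne : toLie (s.i ≫ incl) v ≠ 0 := fun h => hv.ne_zero <| by
    have : toLie s.i v = 0 := Subtype.ext h
    exact (congrArg (fun f => toLie f v) s.retract).symm.trans <|
      (congrArg (toLie s.r) this).trans (map_zero _)
  obtain ⟨r, hr⟩ := Submodule.mem_span_singleton.1 <|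
    hp.mem_span_of_mem_cyclic (hv.map (toLie (s.i ≫ incl)) section_v_ne) (Subtype.property _)
  refine ⟨s.i ≫ incl ≫ biprod.snd, fun h => section_v_ne ?_⟩
  have : r • w = 0 := by
    rw [← snd_p, ← map_smul, hr]
    exact h
  rw [← hr, (smul_eq_zero_iff_left hw.ne_zero).1 this, zero_smul]

theorem nonempty_retract_of_isPrimitive {V W : FinSl3} (hV : Indecomposable V) {v : V} {w : W}
    {a b : ℂ} (hv : IsPrimitive v a b) (hw : IsPrimitive w a b) : Nonempty (Retract V W) := by
  obtain ⟨φ, hφ⟩ := exists_hom_apply_ne_zero_of_isPrimitive hV hv hw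
  have := isIrreducible_of_indecomposable hV
  exact nonempty_retract_of_injective φ <| injective_of_ne_zero fun h => hφ <|
    congrArg (fun f => toLie f v) h

end FDLieMod

/-! ### Tensor powers of the natural module -/

namespace FDLieMod

section Tensor

variable {L : Type} [LieRing L] [LieAlgebra ℂ L] {V W : FDLieMod L}

theorem lie_tmul (x : L) (v : V) (w : W) : ⁅x, tmul v w⁆ = tmul ⁅x, v⁆ w + tmul v ⁅x, w⁆ :=
  TensorProduct.LieModule.lie_tmul_right x v w

theorem zero_tmul (w : W) : tmul (0 : V) w = 0 := TensorProduct.zero_tmul _ _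

theorem tmul_zero (v : V) : tmul v (0 : W) = 0 := TensorProduct.tmul_zero _ _

theorem smul_tmul (c : ℂ) (v : V) (w : W) : tmul (c • v) w = c • tmul v w := rfl

theorem tmul_smul (c : ℂ) (v : V) (w : W) : tmul v (c • w) = c • tmul v w :=
  TensorProduct.tmul_smul c v w

theorem tmul_add (v : V) (w w' : W) : tmul v (w + w') = tmul v w + tmul v w' :=
  TensorProduct.tmul_add v w w'

end Tensor

/-- The standard basis vectors of the natural module. -/
def stdVec (k : Fin 3) : natF := (Pi.single k 1 : Fin 3 → ℂ)

theorem lie_tracelessUnit_stdVec (i j k : Fin 3) : ⁅(tracelessUnit i j : Sl3), stdVec k⁆ =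
    (if j = k then stdVec i else 0) - (if i = j then (1 / 3 : ℂ) else 0) • stdVec k := by
  have hmulVec : ⁅(tracelessUnit i j : Sl3), stdVec k⁆ =
    ((tracelessUnit i j : Sl3).1.mulVec (Pi.single k 1) : Fin 3 → ℂ) := rfl
  have hsingle : ((Matrix.single i j (1 : ℂ)).mulVec (Pi.single k 1) : Fin 3 → ℂ) =
      if j = k then Pi.single i 1 else 0 := by
    ext l
    by_cases hjk : j = k <;> simp [hjk, Matrix.single_apply, Pi.single_apply, eq_comm]
  rw [hmulVec, tracelessUnit_val, Matrix.sub_mulVec, Matrix.smul_mulVec, Matrix.one_mulVec,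
    hsingle, Fintype.card_fin, Nat.cast_ofNat, ← one_div]
  rfl

theorem lie_h₁_stdVec_zero : ⁅h₁, stdVec 0⁆ = stdVec 0 := by
  rw [sub_lie, lie_tracelessUnit_stdVec, lie_tracelessUnit_stdVec]
  simp

theorem lie_h₁_stdVec_one : ⁅h₁, stdVec 1⁆ = -stdVec 1 := by
  rw [sub_lie, lie_tracelessUnit_stdVec, lie_tracelessUnit_stdVec]
  simp only [zero_ne_one, if_true, if_false]
  module

theorem lie_h₂_stdVec_zero : ⁅h₂, stdVec 0⁆ = 0 := by
  rw [sub_lie, lie_tracelessUnit_stdVec, lie_tracelessUnit_stdVec]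
  simp

theorem lie_h₂_stdVec_one : ⁅h₂, stdVec 1⁆ = stdVec 1 := by
  rw [sub_lie, lie_tracelessUnit_stdVec, lie_tracelessUnit_stdVec]
  simp

/-- Contraction of the first tensor factor with the `k`-th coordinate functional. -/
def contractCoord (k : Fin 3) (W : FinSl3) : (natF ⊗ W : FinSl3) →ₗ[ℂ] W :=
  (TensorProduct.lid ℂ W).toLinearMap ∘ₗ
    LinearMap.rTensor W (LinearMap.proj k : (Fin 3 → ℂ) →ₗ[ℂ] ℂ)

theorem contractCoord_tmul_stdVec {W : FinSl3} (k l : Fin 3) (w : W) :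
    contractCoord k W (tmul (stdVec l) w) = if k = l then w else 0 := by
  have : contractCoord k W (tmul (stdVec l) w) = (Pi.single l 1 : Fin 3 → ℂ) k • w := rfl
  rw [this, Pi.single_apply, ite_smul, one_smul, zero_smul]

theorem tmul_stdVec_ne_zero {W : FinSl3} (k : Fin 3) {w : W} (hw : w ≠ 0) :
    tmul (stdVec k) w ≠ 0 := fun h => hw <| by
  simpa only [contractCoord_tmul_stdVec, if_true, map_zero] using congrArg (contractCoord k W) h

end FDLieMod

namespace IsPrimitive

open FDLieMod

variable {W : FinSl3} {w : W} {a b : ℂ}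

theorem tmul_stdVec (hw : IsPrimitive w a b) : IsPrimitive (tmul (stdVec 0) w) (a + 1) b where
  ne_zero := tmul_stdVec_ne_zero 0 hw.ne_zero
  lie_e₁ := by simp [lie_tmul, hw.lie_e₁, lie_tracelessUnit_stdVec, tmul_zero, zero_tmul]
  lie_e₂ := by simp [lie_tmul, hw.lie_e₂, lie_tracelessUnit_stdVec, tmul_zero, zero_tmul]
  lie_h₁ := by rw [lie_tmul, hw.lie_h₁, lie_h₁_stdVec_zero, tmul_smul]; module
  lie_h₂ := by rw [lie_tmul, hw.lie_h₂, lie_h₂_stdVec_zero, zero_tmul, tmul_smul, zero_add]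

theorem wedge_stdVec (hw : IsPrimitive w a b) :
    IsPrimitive (tmul (stdVec 0) (tmul (stdVec 1) w) - tmul (stdVec 1) (tmul (stdVec 0) w))
      a (b + 1) where
  ne_zero h := tmul_stdVec_ne_zero 1 hw.ne_zero <| by
    simpa [contractCoord_tmul_stdVec] using congrArg (contractCoord 0 (natF ⊗ W)) h
  lie_e₁ := by
    simp [lie_sub, lie_tmul, hw.lie_e₁, lie_tracelessUnit_stdVec, tmul_zero, zero_tmul]
  lie_e₂ := by
    simp [lie_sub, lie_tmul, hw.lie_e₂, lie_tracelessUnit_stdVec, tmul_zero, zero_tmul]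
  lie_h₁ := by
    simp only [lie_sub, lie_tmul, hw.lie_h₁, lie_h₁_stdVec_zero, lie_h₁_stdVec_one,
      ← neg_one_smul ℂ (stdVec 1), tmul_add, tmul_smul, smul_tmul]
    module
  lie_h₂ := by
    simp only [lie_sub, lie_tmul, hw.lie_h₂, lie_h₂_stdVec_zero, lie_h₂_stdVec_one, tmul_add,
      tmul_smul, tmul_zero, zero_tmul]
    module

end IsPrimitive

theorem isPrimitive_triv {c : (FDLieMod.triv : FinSl3)} (hc : c ≠ 0) : IsPrimitive c 0 0 where
  ne_zero := hc
  lie_e₁ := rfl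
  lie_e₂ := rfl
  lie_h₁ := (zero_smul ℂ c).symm
  lie_h₂ := (zero_smul ℂ c).symm

theorem exists_isPrimitive_tensorPow_natF (a b : ℕ) :
    ∃ (n : ℕ) (w : (tensorPow natF n : FinSl3)), IsPrimitive w (a : ℂ) (b : ℂ) := by
  induction b with
  | zero =>
    induction a with
    | zero => exact ⟨0, _, Nat.cast_zero (R := ℂ) ▸ isPrimitive_triv (one_ne_zero (α := ℂ))⟩
    | succ a ih =>
      obtain ⟨n, w, hw⟩ := ih
      exact ⟨n + 1, _, Nat.cast_succ (R := ℂ) a ▸ hw.tmul_stdVec⟩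
  | succ b ih =>
    obtain ⟨n, w, hw⟩ := ih
    exact ⟨n + 2, _, Nat.cast_succ (R := ℂ) b ▸ hw.wedge_stdVec⟩

theorem isTensorGenerator_natF : IsTensorGenerator natF := by
  intro V hV
  have := FDLieMod.isIrreducible_of_indecomposable hV
  have := LieModule.nontrivial_of_isIrreducible ℂ Sl3 V
  obtain ⟨v, a, b, hv⟩ := exists_isPrimitive V
  obtain ⟨n, w, hw⟩ := exists_isPrimitive_tensorPow_natF a b
  exact ⟨n, FDLieMod.nonempty_retract_of_isPrimitive hV hv hw⟩

theorem mainTheorem2_general {M : Type*} [Category* M] [Preadditive M] [Linear ℂ M]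
    [HasFiniteBiproducts M] [MonoidalLeftAction FinSl3 M] [IsBilinearAction FinSl3 M]
    [∀ X Y : M, FiniteDimensional ℂ (X ⟶ Y)]
    (hks : IsKrullSchmidt M) (hsimple : IsSimpleModuleCategory FinSl3 M)
    (hgraph : (moduleGraph FinSl3).Isomorphic (moduleGraph M)) :
    ModuleCategoriesEquivalent FinSl3 FinSl3 M :=
  have : Fact (IsKrullSchmidt M) := ⟨hks⟩
  moduleCategoriesEquivalent_of_actionGraph_isomorphic FDLieMod.indecomposable_unit
    isTensorGenerator_natF hsimple hgraph

end

/-- An admissible simple module category over the monoidal category of finite dimensional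
`𝔰𝔩₃(ℂ)`-modules with the same graph and the same dual graph as the left regular module
category is equivalent to the left regular module category. -/
theorem mainTheorem2 {M : Type*} [Category* M] [Preadditive M] [Linear ℂ M]
    [HasFiniteBiproducts M] [MonoidalLeftAction FinSl3 M] [IsBilinearAction FinSl3 M]
    (hadm : IsAdmissible M) (hsimple : IsSimpleModuleCategory FinSl3 M)
    (hgraph : (moduleGraph FinSl3).Isomorphic (moduleGraph M))
    (hdual : (moduleDualGraph FinSl3).Isomorphic (moduleDualGraph M)) :
    ModuleCategoriesEquivalent FinSl3 FinSl3 M :=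
  have := hadm.finiteDimensional
  mainTheorem2_general hadm.krullSchmidt hsimple hgraph
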